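/- Let $K$ be a number field with ring of integers $\mathcal{O}_K$, let $f\in\mathcal{O}_K[X]$ be a monic irreducible polynomial, and let $L/K$ be the splitting field of $f$. Let $\mathcal{A}$ be the set of primes $\mathfrak{p}$ of $K$ (nonzero prime ideals of $\mathcal{O}_K$) such that the reduction of $f$ modulo $\mathfrak{p}$ splits into linear factors over $\mathcal{O}_K/\mathfrak{p}$. Then $\mathcal{A}$ has polar density $\dfrac{1}{[L:K]}$. Here, for a set $\mathcal{A}$ of primes of $K$, put $\zeta_{K,\mathcal{A}}(s)=\prod_{\mathfrak{p}\in\mathcal{A}}\left(1-\mathrm{N}(\mathfrak{p})^{-s}\right)^{-1}$ for $\operatorname{Re}(s)>1$, where $\mathrm{N}(\mathfrak{p})=|\mathcal{O}_K/\mathfrak{p}|$. The set $\mathcal{A}$ has polar density $\dfrac{m}{n}$ if, for some integer $n\ge 1$, the function $\zeta_{K,\mathcal{A}}^{\,n}$ extends to a meromorphic function in a neighbourhood of $s=1$ with a pole of order $m\ge 0$ at $s=1$ (order $0$ meaning holomorphic and nonzero there). -/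

import Mathlib

open Polynomial IsDedekindDomain NumberField

/-- The partial Dedekind zeta function of a set `A` of primes (nonzero prime ideals of the ring of
integers) of the number field `K`, as an Euler product; it is considered for `1 < s.re`, where the
product converges absolutely. -/
noncomputable def partialDedekindZeta {K : Type*} [Field K] [NumberField K]
    (A : Set (HeightOneSpectrum (𝓞 K))) (s : ℂ) : ℂ :=
  ∏' 𝔭 : A, (1 - 1 / (Ideal.absNorm 𝔭.1.asIdeal : ℂ) ^ s)⁻¹

/-- `A` has polar density `d`: for some `n ≥ 1`, the `n`-th power of the partial zeta function of
`A`, given on `1 < s.re`, extends to a meromorphic function in a neighbourhood of `1` with a pole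
of order `m` at `1`, and `d = m / n`. Order `m = 0` means holomorphic and nonvanishing at `1`
(up to a removable singularity). -/
def HasPolarDensity {K : Type*} [Field K] [NumberField K]
    (A : Set (HeightOneSpectrum (𝓞 K))) (d : ℚ) : Prop :=
  ∃ n m : ℕ, 1 ≤ n ∧
    (∃ (U : Set ℂ) (g : ℂ → ℂ), IsOpen U ∧ (1 : ℂ) ∈ U ∧ MeromorphicOn g U ∧
      (∀ s ∈ U, 1 < s.re → g s = partialDedekindZeta A s ^ n) ∧
      meromorphicOrderAt g 1 = ((-(m : ℤ) : ℤ) : WithTop ℤ)) ∧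
    d = (m : ℚ) / (n : ℚ)

/-- The primes `𝔭` of `K` such that `f` splits into linear factors over the residue field
`𝓞 K ⧸ 𝔭`. -/
def splittingPrimes {K : Type*} [Field K] [NumberField K] (f : (𝓞 K)[X]) :
    Set (HeightOneSpectrum (𝓞 K)) :=
  {𝔭 | (f.map (Ideal.Quotient.mk 𝔭.asIdeal)).Splits}

/-! Let `n = [L : K]`. For `1 < s.re` both zeta functions are exponentials of sums of logarithms of
Euler factors. Grouping the primes of `L` by the prime `p` of `K` below them compares `dedekindZeta
L` with the `n`-th power of the partial zeta function. If `f` splits modulo `p`, then, outside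
finitely many `p`, the decomposition groups above `p` are trivial, so `p` has exactly `n` primes
above it, all of norm `N(p)`, and the two contributions agree. If `f` does not split modulo `p`,
every prime above `p` has residue degree at least 2, and the contributions form a series converging
for `s.re > 1/2`. Hence the quotient is `exp H` with `H` holomorphic near 1
(`exists_partialDedekindZeta_pow_eq`), and the density is `1/n` once `dedekindZeta L` is known to be
meromorphic at 1 with a simple pole.

That continuation (`exists_meromorphicOn_eq_dedekindZeta`) is obtained without counting lattice
points. A fundamental domain for the units is replaced by a Lipschitz weight whose unit translates
form a partition of unity up to the factor `torsionOrder K`. The zeta function of an ideal class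
then becomes, up to an elementary factor, a sum `Z(s)` over an ideal `J` of terms homogeneous of
degree `-ds`, where `d` is the degree of the field. Splitting `J` into `k` cosets of `2J` and
comparing each with `2J` itself expresses `(1 - k 2^(-ds)) Z(s)` through differences that decay one
power faster, so it is holomorphic for `s.re > 1 - 1/d`
(`exists_differentiableOn_eq_tsum_coneTerm_mul`). Dividing gives meromorphy, and the known residue
limit gives the order of the pole. -/

/-! ### Tent functions and a partition of unity on `ℝ^r`. -/

/-- The piecewise linear bump function supported on `[-1, 1]` with value `1` at `0`. -/
noncomputable def tent (t : ℝ) : ℝ := max 0 (1 - |t|)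

lemma tent_nonneg (t : ℝ) : 0 ≤ tent t := le_max_left _ _

lemma tent_le_one (t : ℝ) : tent t ≤ 1 :=
  max_le zero_le_one (by linarith [abs_nonneg t])

lemma abs_lt_one_of_tent_ne_zero {t : ℝ} (h : tent t ≠ 0) : |t| < 1 := by
  by_contra! h'
  exact h (max_eq_left (by linarith))

lemma abs_tent_sub_tent_le (s t : ℝ) : |tent s - tent t| ≤ |s - t| := by
  have h := abs_abs_sub_abs_le s t
  have h2 := abs_max_sub_max_le_abs (1 - |s|) (1 - |t|) 0
  rw [max_comm (1 - |s|), max_comm (1 - |t|)] at h2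
  refine h2.trans ?_
  rwa [show 1 - |s| - (1 - |t|) = -(|s| - |t|) by ring, abs_neg]

lemma abs_prod_tent_sub_prod_tent_le {ι : Type*} (S : Finset ι) (f g : ι → ℝ) :
    |∏ i ∈ S, tent (f i) - ∏ i ∈ S, tent (g i)| ≤ ∑ i ∈ S, |f i - g i| := by
  classical
  induction S using Finset.induction_on with
  | empty => simp
  | insert a S ha ih =>
    rw [Finset.prod_insert ha, Finset.prod_insert ha, Finset.sum_insert ha]
    have h1 : |∏ i ∈ S, tent (f i)| ≤ 1 := by
      rw [abs_of_nonneg (Finset.prod_nonneg fun _ _ ↦ tent_nonneg _)]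
      exact Finset.prod_le_one (fun _ _ ↦ tent_nonneg _) (fun _ _ ↦ tent_le_one _)
    have h2 : |tent (g a)| ≤ 1 := by
      rw [abs_of_nonneg (tent_nonneg _)]; exact tent_le_one _
    calc _ = |(tent (f a) - tent (g a)) * ∏ i ∈ S, tent (f i) +
          tent (g a) * (∏ i ∈ S, tent (f i) - ∏ i ∈ S, tent (g i))| := by congr 1; ring
      _ ≤ |tent (f a) - tent (g a)| * |∏ i ∈ S, tent (f i)| +
          |tent (g a)| * |∏ i ∈ S, tent (f i) - ∏ i ∈ S, tent (g i)| := by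
        rw [← abs_mul, ← abs_mul]; exact abs_add_le _ _
      _ ≤ |f a - g a| * 1 + 1 * ∑ i ∈ S, |f i - g i| := by
        exact add_le_add
          (mul_le_mul (abs_tent_sub_tent_le _ _) h1 (abs_nonneg _) (abs_nonneg _))
          (mul_le_mul h2 ih (abs_nonneg _) zero_le_one)
      _ = _ := by ring

/-- The integer translates of a product of tent functions form a partition of unity. -/
lemma hasSum_prod_tent_add_intCast {ι : Type*} [Fintype ι] (y : ι → ℝ) :
    HasSum (fun m : ι → ℤ ↦ ∏ i, tent (y i + m i)) 1 := by
  classical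
  -- Only these two shifts can bring `y i` into `(-1, 1)`; with `θ` the fractional part of `y i`,
  -- the tents there are `1 - θ` and `θ`.
  let t : ι → Finset ℤ := fun i ↦ {-⌊y i⌋, -⌊y i⌋ - 1}
  have h1 : ∏ i, ∑ j ∈ t i, tent (y i + j) = 1 := by
    refine Finset.prod_eq_one fun i _ ↦ ?_
    rw [Finset.sum_pair (by lia)]
    push_cast
    have h0 := Int.floor_le (y i)
    have h0' := Int.lt_floor_add_one (y i)
    rw [tent, tent, abs_of_nonneg (by linarith), abs_of_nonpos (by linarith),
      max_eq_right (by linarith), max_eq_right (by linarith)]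
    ring
  rw [Finset.prod_univ_sum] at h1
  rw [← h1]
  refine hasSum_sum_of_ne_finset_zero fun m hm ↦ ?_
  obtain ⟨i, hi⟩ : ∃ i, m i ∉ t i := by simpa [Fintype.mem_piFinset] using hm
  refine Finset.prod_eq_zero (Finset.mem_univ i) ?_
  by_contra h
  have h2 := abs_lt.mp (abs_lt_one_of_tent_ne_zero h)
  apply hi
  have h3 : -⌊y i⌋ - 1 ≤ m i := by
    have : (-⌊y i⌋ - 2 : ℝ) < m i := by linarith [Int.lt_floor_add_one (y i)]
    have : -⌊y i⌋ - 2 < m i := by exact_mod_cast this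
    lia
  have h4 : m i ≤ -⌊y i⌋ := by
    have : (m i : ℝ) < -⌊y i⌋ + 1 := by linarith [Int.floor_le (y i)]
    have : m i < -⌊y i⌋ + 1 := by exact_mod_cast this
    lia
  simp only [t, Finset.mem_insert, Finset.mem_singleton]
  lia

/-- Meant for units written as torsion times `ℤ^r`: the weight ignores the torsion factor, which
only contributes its order. -/
lemma HasSum.snd_of_nonneg {α β : Type*} {g : β → ℝ} {c a : ℝ}
    (hα : HasSum (fun _ : α ↦ (1 : ℝ)) c) (hg : HasSum g a) (h0 : ∀ b, 0 ≤ g b) :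
    HasSum (fun p : α × β ↦ g p.2) (c * a) := by
  have h := hα.mul hg (hα.summable.mul_of_nonneg hg.summable (fun _ ↦ zero_le_one) h0)
  simpa only [one_mul] using h

/-! ### A weight replacing a fundamental domain for the unit group. -/

section ConeWeight

open NumberField.Units NumberField.InfinitePlace NumberField.mixedEmbedding
open NumberField.mixedEmbedding.fundamentalCone NumberField.Units.dirichletUnitTheorem

variable {K : Type*} [Field K] [NumberField K]

open scoped Classical in
/-- The basis of the logarithmic space attached to the fundamental system of units. -/
noncomputable def logSpaceBasis (K : Type*) [Field K] [NumberField K] :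
    Module.Basis (Fin (rank K)) ℝ (logSpace K) :=
  (basisUnitLattice K).ofZLatticeBasis ℝ (unitLattice K)

lemma logSpaceBasis_apply (i : Fin (rank K)) :
    logSpaceBasis K i = basisUnitLattice K i := by
  classical
  exact Module.Basis.ofZLatticeBasis_apply ..

/-- The coordinates of the logarithmic map with respect to the fundamental system of units. -/
noncomputable def unitCoord (x : mixedSpace K) (i : Fin (rank K)) : ℝ :=
  (logSpaceBasis K).repr (logMap x) i

/-- A function on the mixed space, invariant under scaling, whose translates by the units modulo
torsion form a partition of unity. -/
noncomputable def coneWeight (x : mixedSpace K) : ℝ := ∏ i, tent (unitCoord x i)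

lemma coneWeight_nonneg (x : mixedSpace K) : 0 ≤ coneWeight x :=
  Finset.prod_nonneg fun _ _ ↦ tent_nonneg _

lemma coneWeight_le_one (x : mixedSpace K) : coneWeight x ≤ 1 :=
  Finset.prod_le_one (fun _ _ ↦ tent_nonneg _) (fun _ _ ↦ tent_le_one _)

lemma coneWeight_smul {x : mixedSpace K} (hx : mixedEmbedding.norm x ≠ 0) {c : ℝ} (hc : c ≠ 0) :
    coneWeight (c • x) = coneWeight x := by
  simp only [coneWeight, unitCoord, logMap_real_smul hx hc]

/-- The logarithmic embedding kills torsion and carries the fundamental system to the chosen basis,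
so units act on coordinates by integer translations. -/
lemma unitCoord_unit_smul (ζ : torsion K) (m : Fin (rank K) → ℤ) {x : mixedSpace K}
    (hx : mixedEmbedding.norm x ≠ 0) (i : Fin (rank K)) :
    unitCoord (((ζ : (𝓞 K)ˣ) * ∏ i, fundSystem K i ^ m i) • x) i = unitCoord x i + m i := by
  have h : logEmbedding K (Additive.ofMul ((ζ : (𝓞 K)ˣ) * ∏ i, fundSystem K i ^ m i)) =
      ∑ i, (m i : ℝ) • logSpaceBasis K i := by
    rw [ofMul_mul, map_add, logEmbedding_eq_zero_iff.mpr ζ.2, zero_add, ofMul_prod, map_sum]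
    refine Finset.sum_congr rfl fun j _ ↦ ?_
    rw [ofMul_zpow, map_zsmul, logEmbedding_fundSystem, logSpaceBasis_apply,
      Int.cast_smul_eq_zsmul]
  rw [unitCoord, logMap_unit_smul _ hx, map_add, Finsupp.add_apply, h, Module.Basis.repr_sum_self,
    unitCoord, add_comm]

lemma bijective_torsion_mul_prod_fundSystem :
    Function.Bijective fun p : torsion K × (Fin (rank K) → ℤ) ↦
      (p.1 : (𝓞 K)ˣ) * ∏ i, fundSystem K i ^ p.2 i := by
  rw [Function.bijective_iff_existsUnique]
  intro u
  obtain ⟨p, hp, hp'⟩ := exist_unique_eq_mul_prod K u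
  exact ⟨p, hp.symm, fun q hq ↦ hp' q hq.symm⟩

lemma hasSum_one_torsion : HasSum (fun _ : torsion K ↦ (1 : ℝ)) (torsionOrder K) := by
  have := Fintype.ofFinite (torsion K)
  have h := hasSum_fintype (fun _ : torsion K ↦ (1 : ℝ))
  rwa [Finset.sum_const, nsmul_one, Finset.card_univ, ← Nat.card_eq_fintype_card] at h

lemma hasSum_coneWeight_unit_smul {x : mixedSpace K} (hx : mixedEmbedding.norm x ≠ 0) :
    HasSum (fun u : (𝓞 K)ˣ ↦ coneWeight (u • x)) (torsionOrder K) := by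
  have h5 := HasSum.snd_of_nonneg (hasSum_one_torsion (K := K))
    (hasSum_prod_tent_add_intCast (unitCoord x)) fun _ ↦ Finset.prod_nonneg fun _ _ ↦ tent_nonneg _
  rw [mul_one] at h5
  let e : torsion K × (Fin (rank K) → ℤ) ≃ (𝓞 K)ˣ :=
    Equiv.ofBijective _ bijective_torsion_mul_prod_fundSystem
  refine (Equiv.hasSum_iff e).mp (h5.congr_fun fun p ↦ ?_)
  rw [Function.comp_apply, Equiv.ofBijective_apply, coneWeight]
  exact Finset.prod_congr rfl fun i _ ↦ by rw [unitCoord_unit_smul _ _ hx]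

end ConeWeight

/-! ### Size and variation estimates on the support of the weight. -/

section ConeEstimates

open scoped Classical

open NumberField.Units NumberField.InfinitePlace NumberField.mixedEmbedding
open NumberField.mixedEmbedding.fundamentalCone NumberField.Units.dirichletUnitTheorem

lemma one_le_mult {K : Type*} [Field K] (w : InfinitePlace K) : (1 : ℝ) ≤ mult w := by
  exact_mod_cast mult_pos

lemma mult_le_two {K : Type*} [Field K] (w : InfinitePlace K) : (mult w : ℝ) ≤ 2 := by
  rw [mult]; split_ifs <;> norm_num

variable {K : Type*} [Field K] [NumberField K]

lemma sum_mult_cast : ∑ w : InfinitePlace K, (mult w : ℝ) = Module.finrank ℚ K := by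
  rw [← sum_mult_eq]; push_cast; rfl

lemma normAtPlace_le_norm (w : InfinitePlace K) (x : mixedSpace K) : normAtPlace w x ≤ ‖x‖ := by
  rw [norm_eq_sup'_normAtPlace]
  exact Finset.le_sup' (fun w ↦ normAtPlace w x) (Finset.mem_univ w)

lemma normAtPlace_sub_le (w : InfinitePlace K) (x y : mixedSpace K) :
    |normAtPlace w x - normAtPlace w y| ≤ ‖x - y‖ := by
  have h1 := normAtPlace_add_le w (x - y) y
  have h2 := normAtPlace_add_le w (y - x) x
  rw [sub_add_cancel] at h1 h2
  have h3 := normAtPlace_le_norm w (x - y)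
  have h4 := normAtPlace_le_norm w (y - x)
  rw [norm_sub_rev] at h4
  exact abs_sub_le_iff.mpr ⟨by linarith, by linarith⟩

lemma normAtPlace_pos {x : mixedSpace K} (hx : mixedEmbedding.norm x ≠ 0) (w : InfinitePlace K) :
    0 < normAtPlace w x :=
  (normAtPlace_nonneg w x).lt_of_ne' (mixedEmbedding.norm_ne_zero_iff.mp hx w)

lemma log_norm_eq_sum {x : mixedSpace K} (hx : mixedEmbedding.norm x ≠ 0) :
    Real.log (mixedEmbedding.norm x) = ∑ w, mult w * Real.log (normAtPlace w x) := by
  rw [mixedEmbedding.norm_apply, Real.log_prod fun w _ ↦ pow_ne_zero _ (normAtPlace_pos hx w).ne']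
  simp only [Real.log_pow]

lemma pow_finrank_le_norm {x : mixedSpace K} {t : ℝ} (ht : 0 ≤ t)
    (h : ∀ w, t ≤ normAtPlace w x) : t ^ Module.finrank ℚ K ≤ mixedEmbedding.norm x := by
  rw [mixedEmbedding.norm_apply, ← sum_mult_eq, ← Finset.prod_pow_eq_pow_sum]
  exact Finset.prod_le_prod (fun _ _ ↦ by positivity) fun w _ ↦ pow_le_pow_left₀ ht (h w) _

/-- Where the weight is nonzero the unit coordinates are bounded, hence so is the deviation of each
`log |x|_w` from the mean `log N(x) / d`. All archimedean absolute values are then comparable, in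
particular with the largest one, which is `‖x‖`. -/
lemma exists_mul_norm_le_normAtPlace (K : Type*) [Field K] [NumberField K] :
    ∃ c : ℝ, 0 < c ∧ ∀ x : mixedSpace K, mixedEmbedding.norm x ≠ 0 → coneWeight x ≠ 0 →
      ∀ w, c * ‖x‖ ≤ normAtPlace w x := by
  let b := logSpaceBasis K
  let M : ℝ := ∑ i, ∑ w, |b i w|
  let M' : ℝ := M + ∑ w : {w : InfinitePlace K // w ≠ w₀}, M
  have hM : 0 ≤ M := Finset.sum_nonneg fun _ _ ↦ Finset.sum_nonneg fun _ _ ↦ abs_nonneg _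
  -- Each deviation is at most `M'` in absolute value, so two logarithms differ by at most `2 * M'`.
  refine ⟨Real.exp (-(2 * M')), Real.exp_pos _, fun x hx hF w ↦ ?_⟩
  have hcoord : ∀ i, |unitCoord x i| ≤ 1 := fun i ↦
    (abs_lt_one_of_tent_ne_zero (Finset.prod_ne_zero_iff.mp hF i (Finset.mem_univ i))).le
  have hlog : ∀ w, |logMap x w| ≤ M := fun w ↦ by
    have h1 : logMap x = ∑ i, unitCoord x i • b i := (b.sum_repr (logMap x)).symm
    rw [h1, Finset.sum_apply]
    refine (Finset.abs_sum_le_sum_abs _ _).trans (Finset.sum_le_sum fun i _ ↦ ?_)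
    rw [Pi.smul_apply, smul_eq_mul, abs_mul]
    calc _ ≤ 1 * |b i w| := by gcongr; exact hcoord i
      _ ≤ ∑ w, |b i w| := by
        rw [one_mul]
        exact Finset.single_le_sum (f := fun w ↦ |b i w|) (fun _ _ ↦ abs_nonneg _)
          (Finset.mem_univ w)
  let δ : InfinitePlace K → ℝ := fun w ↦ Real.log (normAtPlace w x) -
    Real.log (mixedEmbedding.norm x) * (Module.finrank ℚ K : ℝ)⁻¹
  have hd : (Module.finrank ℚ K : ℝ) ≠ 0 := Nat.cast_ne_zero.mpr Module.finrank_pos.ne'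
  have hsum : ∑ w, mult w * δ w = 0 := by
    simp only [δ, mul_sub, Finset.sum_sub_distrib]
    rw [← log_norm_eq_sum hx, ← Finset.sum_mul, sum_mult_cast]
    field_simp
    ring
  have hδ' : ∀ w, |δ w| ≤ |mult w * δ w| := fun w ↦ by
    rw [abs_mul, Nat.abs_cast]
    exact le_mul_of_one_le_left (abs_nonneg _) (one_le_mult w)
  have hM' : M ≤ M' := le_add_of_nonneg_right (Finset.sum_nonneg fun _ _ ↦ hM)
  have hδ : ∀ w, |δ w| ≤ M' := fun w ↦ by
    refine (hδ' w).trans ?_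
    -- The place `w₀` is missing from `logSpace`; its deviation is recovered from the others because
    -- the weighted deviations sum to zero.
    by_cases hw : w = w₀
    · subst hw
      rw [Fintype.sum_eq_add_sum_subtype_ne _ w₀, add_eq_zero_iff_eq_neg] at hsum
      rw [hsum, abs_neg]
      exact ((Finset.abs_sum_le_sum_abs _ _).trans (Finset.sum_le_sum fun w _ ↦ hlog w)).trans
        (le_add_of_nonneg_left hM)
    · exact (hlog ⟨w, hw⟩).trans hM'
  obtain ⟨w', -, hw'⟩ := Finset.exists_mem_eq_sup' Finset.univ_nonempty
    (fun w ↦ normAtPlace w x)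
  rw [norm_eq_sup'_normAtPlace, hw']
  rw [← Real.exp_log (normAtPlace_pos hx w), ← Real.exp_log (normAtPlace_pos hx w'),
    ← Real.exp_add]
  apply Real.exp_le_exp.mpr
  have h1 := abs_le.mp (hδ w)
  have h2 := abs_le.mp (hδ w')
  simp only [δ] at h1 h2
  linarith

lemma abs_log_norm_sub_le {x y : mixedSpace K} (hx : mixedEmbedding.norm x ≠ 0)
    (hy : mixedEmbedding.norm y ≠ 0) {D : ℝ}
    (h : ∀ w, |Real.log (normAtPlace w x) - Real.log (normAtPlace w y)| ≤ D) :
    |Real.log (mixedEmbedding.norm x) - Real.log (mixedEmbedding.norm y)| ≤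
      Module.finrank ℚ K * D := by
  rw [log_norm_eq_sum hx, log_norm_eq_sum hy, ← Finset.sum_sub_distrib, ← sum_mult_cast,
    Finset.sum_mul]
  refine (Finset.abs_sum_le_sum_abs _ _).trans (Finset.sum_le_sum fun w _ ↦ ?_)
  rw [← mul_sub, abs_mul, Nat.abs_cast]
  exact mul_le_mul_of_nonneg_left (h w) (Nat.cast_nonneg _)

/-- Tents are 1-Lipschitz and the unit coordinates are linear in `logMap`, so the weight is
Lipschitz in the logarithms of the absolute values. The factor 4 below is `mult w ≤ 2` times one `D`
from the place and one from the averaged logarithm of the norm. -/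
lemma exists_abs_coneWeight_sub_le (K : Type*) [Field K] [NumberField K] :
    ∃ C : ℝ, 0 ≤ C ∧ ∀ x y : mixedSpace K, mixedEmbedding.norm x ≠ 0 → mixedEmbedding.norm y ≠ 0 →
      ∀ D : ℝ, (∀ w, |Real.log (normAtPlace w x) - Real.log (normAtPlace w y)| ≤ D) →
        |coneWeight x - coneWeight y| ≤ C * D := by
  let b := logSpaceBasis K
  refine ⟨∑ i, ∑ w, 4 * |b.repr (Pi.single w 1) i|,
    Finset.sum_nonneg fun _ _ ↦ Finset.sum_nonneg fun _ _ ↦ by positivity,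
    fun x y hx hy D hD ↦ ?_⟩
  have hd : (Module.finrank ℚ K : ℝ) ≠ 0 := Nat.cast_ne_zero.mpr Module.finrank_pos.ne'
  have hlog : ∀ w, |(logMap x - logMap y) w| ≤ 4 * D := fun w ↦ by
    have h2 := abs_log_norm_sub_le hx hy hD
    have h3 : |(Real.log (mixedEmbedding.norm x) - Real.log (mixedEmbedding.norm y)) *
        (Module.finrank ℚ K : ℝ)⁻¹| ≤ D := by
      rw [abs_mul, abs_inv, Nat.abs_cast, ← div_eq_mul_inv]
      exact div_le_of_le_mul₀ (Nat.cast_nonneg _) ((abs_nonneg _).trans (hD w)) (by linarith)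
    rw [Pi.sub_apply, logMap_apply, logMap_apply, ← mul_sub, abs_mul, Nat.abs_cast,
      show (4 : ℝ) * D = 2 * (D + D) by ring]
    refine mul_le_mul (mult_le_two _) ?_ (abs_nonneg _) zero_le_two
    refine le_trans (le_of_eq ?_) ((abs_sub _ _).trans (add_le_add (hD w) h3))
    congr 1
    ring
  refine (abs_prod_tent_sub_prod_tent_le _ _ _).trans ?_
  rw [Finset.sum_mul]
  refine Finset.sum_le_sum fun i _ ↦ ?_
  have h1 : unitCoord x i - unitCoord y i = ∑ w, (logMap x - logMap y) w *
      b.repr (Pi.single w 1) i := by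
    rw [unitCoord, unitCoord, ← Finsupp.sub_apply, ← map_sub]
    have := LinearMap.pi_apply_eq_sum_univ (b.coord i) (logMap x - logMap y)
    rw [Module.Basis.coord_apply] at this
    rw [this]
    refine Finset.sum_congr rfl fun w _ ↦ ?_
    rw [smul_eq_mul, Module.Basis.coord_apply]
    congr 3
    ext j
    simp [Pi.single_apply, eq_comm]
  rw [h1, Finset.sum_mul]
  refine (Finset.abs_sum_le_sum_abs _ _).trans (Finset.sum_le_sum fun w _ ↦ ?_)
  rw [abs_mul, mul_right_comm]
  exact mul_le_mul_of_nonneg_right (hlog w) (abs_nonneg _)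

end ConeEstimates

/-! ### Decay of the weighted terms and of their differences. -/

lemma abs_log_sub_log_le {a b t : ℝ} (ht : 0 < t) (ha : t ≤ a) (hb : t ≤ b) :
    |Real.log a - Real.log b| ≤ |a - b| / t := by
  wlog h : b ≤ a generalizing a b
  · rw [abs_sub_comm, abs_sub_comm a]
    exact this hb ha (le_of_not_ge h)
  have hb' := ht.trans_le hb
  have ha' := ht.trans_le ha
  rw [abs_of_nonneg (sub_nonneg.mpr (Real.log_le_log hb' h)), abs_of_nonneg (sub_nonneg.mpr h),
    ← Real.log_div ha'.ne' hb'.ne']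
  calc Real.log (a / b) ≤ a / b - 1 := Real.log_le_sub_one_of_pos (div_pos ha' hb')
    _ = (a - b) / b := by field_simp
    _ ≤ (a - b) / t := div_le_div_of_nonneg_left (sub_nonneg.mpr h) ht hb

lemma norm_cpow_neg_sub_cpow_neg_le {a b : ℝ} (ha : 0 < a) (hb : 0 < b) (s : ℂ) {B D : ℝ}
    (hs : ‖s‖ ≤ B) (hD : |Real.log a - Real.log b| ≤ D) :
    ‖(a : ℂ) ^ (-s) - (b : ℂ) ^ (-s)‖ ≤ a ^ (-s.re) * (B * D * Real.exp (B * D)) := by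
  have hB : 0 ≤ B := (norm_nonneg _).trans hs
  have ha' : (a : ℂ) ≠ 0 := Complex.ofReal_ne_zero.mpr ha.ne'
  have hb' : (b : ℂ) ≠ 0 := Complex.ofReal_ne_zero.mpr hb.ne'
  let z : ℂ := s * ((Real.log a - Real.log b : ℝ) : ℂ)
  have hz : ‖z‖ ≤ B * D := by
    rw [norm_mul, Complex.norm_real, Real.norm_eq_abs]
    exact mul_le_mul hs hD (abs_nonneg _) hB
  have h1 : (a : ℂ) ^ (-s) - (b : ℂ) ^ (-s) = -((a : ℂ) ^ (-s) * (Complex.exp z - 1)) := by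
    rw [mul_sub, Complex.cpow_def_of_ne_zero ha', Complex.cpow_def_of_ne_zero hb', ← Complex.exp_add,
      ← Complex.ofReal_log ha.le, ← Complex.ofReal_log hb.le]
    simp only [z]
    push_cast
    ring_nf
  have h2 : ‖Complex.exp z - 1‖ ≤ ‖z‖ * Real.exp ‖z‖ := by
    simpa using Complex.norm_exp_sub_sum_le_norm_mul_exp z 1
  rw [h1, norm_neg, norm_mul, Complex.norm_cpow_eq_rpow_re_of_pos ha, Complex.neg_re]
  have hBD : 0 ≤ B * D := (norm_nonneg _).trans hz
  exact mul_le_mul_of_nonneg_left (h2.trans (by gcongr)) (by positivity)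

section ConeTerm

open scoped Classical

open NumberField.Units NumberField.InfinitePlace NumberField.mixedEmbedding
open NumberField.mixedEmbedding.fundamentalCone NumberField.Units.dirichletUnitTheorem

variable {K : Type*} [Field K] [NumberField K]

/-- The function `|N x| ^ (-s)` weighted by `coneWeight`. -/
noncomputable def coneTerm (s : ℂ) (x : mixedSpace K) : ℂ :=
  coneWeight x * (mixedEmbedding.norm x : ℂ) ^ (-s)

lemma norm_pos_of_ne_zero {x : mixedSpace K} (hx : mixedEmbedding.norm x ≠ 0) :
    0 < mixedEmbedding.norm x :=
  (mixedEmbedding.norm_nonneg x).lt_of_ne' hx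

lemma coneTerm_two_smul (s : ℂ) {x : mixedSpace K} (hx : mixedEmbedding.norm x ≠ 0) :
    coneTerm s ((2 : ℝ) • x) = (2 : ℂ) ^ (-(Module.finrank ℚ K * s)) * coneTerm s x := by
  rw [coneTerm, coneTerm, coneWeight_smul hx two_ne_zero, mixedEmbedding.norm_smul, abs_two,
    Complex.ofReal_mul, Complex.mul_cpow_ofReal_nonneg (by positivity)
      (mixedEmbedding.norm_nonneg x), Complex.ofReal_pow, ← Complex.cpow_nat_mul', neg_mul_eq_mul_neg]
  · push_cast; ring_nf
  all_goals
    rw [show ((2 : ℝ) : ℂ) = 2 by norm_num]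
    rw [show (2 : ℂ) = ((2 : ℝ) : ℂ) by norm_num, Complex.arg_ofReal_of_nonneg zero_le_two]
    simp [Real.pi_pos, Real.pi_pos.le]

lemma norm_coneTerm {x : mixedSpace K} (hx : mixedEmbedding.norm x ≠ 0) (s : ℂ) :
    ‖coneTerm s x‖ = coneWeight x * mixedEmbedding.norm x ^ (-s.re) := by
  rw [coneTerm, norm_mul, Complex.norm_real, Real.norm_of_nonneg (coneWeight_nonneg x),
    Complex.norm_cpow_eq_rpow_re_of_pos (norm_pos_of_ne_zero hx), Complex.neg_re]

lemma rpow_neg_le_of_pow_finrank_le {N t σ τ : ℝ} {d : ℕ} (ht : 1 ≤ t) (hN : t ^ d ≤ N)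
    (hσ : 0 ≤ σ) (hτ : σ ≤ τ) : N ^ (-τ) ≤ t ^ (-(d * σ)) := by
  have h1 : 1 ≤ t ^ d := one_le_pow₀ ht
  calc N ^ (-τ) ≤ N ^ (-σ) := Real.rpow_le_rpow_of_exponent_le (h1.trans hN) (by linarith)
    _ ≤ (t ^ d) ^ (-σ) := Real.rpow_le_rpow_of_nonpos (by linarith) hN (by linarith)
    _ = t ^ (-(d * σ)) := by
      rw [← Real.rpow_natCast, ← Real.rpow_mul (by linarith)]; ring_nf

/-- On the support of the weight every absolute value of `x` is at least a multiple of `‖x‖`, so a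
move of length `R` changes each logarithm by `O(R / ‖x‖)`. This gains one power of `‖x‖` over the
size of the term itself. -/
lemma exists_norm_coneTerm_sub_le_of_ne_zero (K : Type*) [Field K] [NumberField K] {σ B R : ℝ}
    (hσ : 0 ≤ σ) (hB : 0 ≤ B) (hR : 0 ≤ R) :
    ∃ C T : ℝ, 0 ≤ C ∧ 0 < T ∧ ∀ s : ℂ, σ ≤ s.re → ‖s‖ ≤ B → ∀ x y : mixedSpace K,
      mixedEmbedding.norm x ≠ 0 → mixedEmbedding.norm y ≠ 0 → ‖x - y‖ ≤ R → T ≤ ‖x‖ →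
      coneWeight x ≠ 0 →
      ‖coneTerm s x - coneTerm s y‖ ≤ C * ‖x‖ ^ (-(Module.finrank ℚ K * σ + 1)) := by
  obtain ⟨c, hc, hcone⟩ := exists_mul_norm_le_normAtPlace K
  obtain ⟨A, hA, hlip⟩ := exists_abs_coneWeight_sub_le K
  let d := Module.finrank ℚ K
  let C₀ := A + B * d * Real.exp (B * d)
  -- The threshold forces `t = c/2 * ‖x‖ ≥ R + 1`. Since `|x|_w ≥ 2t`, also `|y|_w ≥ 2t - R ≥ t`,
  -- and `R / t ≤ 1` keeps the exponential bounded.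
  refine ⟨C₀ * R * (c / 2) ^ (-(d * σ + 1)), (R + 1) * (2 / c), by positivity, by positivity,
    fun s hs hsB x y hx hy hxy hTx hFx ↦ ?_⟩
  set t := c / 2 * ‖x‖ with ht
  have ht' : R + 1 ≤ t := by
    rw [ht]
    calc R + 1 = c / 2 * ((R + 1) * (2 / c)) := by field_simp
      _ ≤ _ := by gcongr
  have ht1 : 1 ≤ t := by linarith
  have ht0 : 0 < t := by linarith
  have hwx : ∀ w, t ≤ normAtPlace w x := fun w ↦ by
    have := hcone x hx hFx w
    have : c * ‖x‖ = 2 * t := by rw [ht]; ring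
    linarith
  have hwy : ∀ w, t ≤ normAtPlace w y := fun w ↦ by
    have h1 := hcone x hx hFx w
    have h2 : c * ‖x‖ = 2 * t := by rw [ht]; ring
    have h3 := abs_le.mp ((normAtPlace_sub_le w x y).trans hxy)
    linarith
  have hD : ∀ w, |Real.log (normAtPlace w x) - Real.log (normAtPlace w y)| ≤ R / t := fun w ↦
    (abs_log_sub_log_le ht0 (hwx w) (hwy w)).trans
      (div_le_div_of_nonneg_right ((normAtPlace_sub_le w x y).trans hxy) ht0.le)
  have hD0 : 0 ≤ R / t := by positivity
  have hD1 : R / t ≤ 1 := (div_le_one ht0).mpr (by linarith)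
  have hNx := rpow_neg_le_of_pow_finrank_le ht1 (pow_finrank_le_norm ht0.le hwx) hσ hs
  have hW := hlip x y hx hy _ hD
  have hlogN := abs_log_norm_sub_le hx hy hD
  have hpow := norm_cpow_neg_sub_cpow_neg_le (norm_pos_of_ne_zero hx) (norm_pos_of_ne_zero hy) s
    hsB hlogN
  have hsplit : coneTerm s x - coneTerm s y =
      ((coneWeight x - coneWeight y : ℝ) : ℂ) * (mixedEmbedding.norm x : ℂ) ^ (-s) +
      (coneWeight y : ℂ) * ((mixedEmbedding.norm x : ℂ) ^ (-s) -
        (mixedEmbedding.norm y : ℂ) ^ (-s)) := by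
    rw [coneTerm, coneTerm]; push_cast; ring
  have hexp : Real.exp (B * (d * (R / t))) ≤ Real.exp (B * d) := by
    apply Real.exp_le_exp.mpr
    rw [← mul_assoc]
    exact mul_le_of_le_one_right (by positivity) hD1
  calc ‖coneTerm s x - coneTerm s y‖
      ≤ |coneWeight x - coneWeight y| * mixedEmbedding.norm x ^ (-s.re) +
        coneWeight y * ‖(mixedEmbedding.norm x : ℂ) ^ (-s) -
          (mixedEmbedding.norm y : ℂ) ^ (-s)‖ := by
        rw [hsplit]
        refine (norm_add_le _ _).trans (le_of_eq ?_)
        rw [norm_mul, norm_mul, Complex.norm_real, Complex.norm_real, Real.norm_eq_abs,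
          Real.norm_of_nonneg (coneWeight_nonneg y),
          Complex.norm_cpow_eq_rpow_re_of_pos (norm_pos_of_ne_zero hx), Complex.neg_re]
    _ ≤ A * (R / t) * t ^ (-(d * σ)) +
        1 * (t ^ (-(d * σ)) * (B * (d * (R / t)) * Real.exp (B * d))) := by
        refine add_le_add (mul_le_mul hW hNx (Real.rpow_nonneg (mixedEmbedding.norm_nonneg x) _)
          (by positivity)) (mul_le_mul (coneWeight_le_one y) (hpow.trans ?_) (norm_nonneg _)
          zero_le_one)
        exact mul_le_mul hNx (mul_le_mul_of_nonneg_left hexp (by positivity)) (by positivity)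
          (by positivity)
    _ = C₀ * R * (t ^ (-(d * σ)) * t ^ (-1 : ℝ)) := by
        rw [Real.rpow_neg_one]
        simp only [C₀]
        field_simp
    _ = C₀ * R * (c / 2) ^ (-(d * σ + 1)) * ‖x‖ ^ (-(d * σ + 1)) := by
        rw [← Real.rpow_add ht0, ← neg_add, ht, Real.mul_rpow (by positivity) (norm_nonneg _)]
        ring

/-- If the weight vanishes at `x` but not at `y`, the roles are exchanged; `‖y‖ ≥ ‖x‖ / 2` then
costs the factor `2 ^ ρ`. The condition `R < T` later keeps translates of large lattice points away
from 0. -/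
lemma exists_norm_coneTerm_sub_le (K : Type*) [Field K] [NumberField K] {σ B R : ℝ}
    (hσ : 0 ≤ σ) (hB : 0 ≤ B) (hR : 0 ≤ R) :
    ∃ C T : ℝ, 0 ≤ C ∧ R < T ∧ ∀ s : ℂ, σ ≤ s.re → ‖s‖ ≤ B → ∀ x y : mixedSpace K,
      mixedEmbedding.norm x ≠ 0 → mixedEmbedding.norm y ≠ 0 → ‖x - y‖ ≤ R → T ≤ ‖x‖ →
      ‖coneTerm s x - coneTerm s y‖ ≤ C * ‖x‖ ^ (-(Module.finrank ℚ K * σ + 1)) := by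
  obtain ⟨C, T, hC, hT, h⟩ := exists_norm_coneTerm_sub_le_of_ne_zero K hσ hB hR
  let ρ := Module.finrank ℚ K * σ + 1
  have hρ : 0 ≤ ρ := by positivity
  refine ⟨C * 2 ^ ρ, 2 * T + 2 * R, by positivity, by linarith,
    fun s hs hsB x y hx hy hxy hTx ↦ ?_⟩
  have hxpos : 0 < ‖x‖ := by linarith
  by_cases hFx : coneWeight x = 0
  · by_cases hFy : coneWeight y = 0
    · rw [coneTerm, coneTerm, hFx, hFy]
      simp only [Complex.ofReal_zero, zero_mul, sub_zero, norm_zero]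
      positivity
    · have hy' : ‖x‖ / 2 ≤ ‖y‖ := by
        have := norm_sub_norm_le x y
        linarith
      rw [norm_sub_rev]
      refine (h s hs hsB y x hy hx (by rwa [norm_sub_rev]) (by linarith) hFy).trans ?_
      rw [mul_assoc]
      gcongr
      calc ‖y‖ ^ (-ρ) ≤ (‖x‖ / 2) ^ (-ρ) :=
            Real.rpow_le_rpow_of_nonpos (by positivity) hy' (by linarith)
        _ = 2 ^ ρ * ‖x‖ ^ (-ρ) := by
          rw [Real.div_rpow hxpos.le zero_le_two, Real.rpow_neg zero_le_two]
          field_simp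
  · refine (h s hs hsB x y hx hy hxy (by linarith) hFx).trans ?_
    gcongr
    exact le_mul_of_one_le_right hC (Real.one_le_rpow one_le_two hρ)

lemma exists_norm_coneTerm_le (K : Type*) [Field K] [NumberField K] (s : ℂ) (hs : 0 ≤ s.re) :
    ∃ C : ℝ, 0 ≤ C ∧ ∀ x : mixedSpace K, mixedEmbedding.norm x ≠ 0 →
      ‖coneTerm s x‖ ≤ C * ‖x‖ ^ (-(Module.finrank ℚ K * s.re)) := by
  obtain ⟨c, hc, hcone⟩ := exists_mul_norm_le_normAtPlace K
  refine ⟨c ^ (-(Module.finrank ℚ K * s.re)), by positivity, fun x hx ↦ ?_⟩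
  rw [norm_coneTerm hx]
  by_cases hF : coneWeight x = 0
  · rw [hF, zero_mul]; positivity
  have hx0 : 0 < ‖x‖ := norm_pos_iff.mpr fun h ↦ hx (by rw [h, map_zero])
  have h1 := pow_finrank_le_norm (by positivity) (hcone x hx hF)
  calc _ ≤ 1 * ((c * ‖x‖) ^ Module.finrank ℚ K) ^ (-s.re) := by
        refine mul_le_mul (coneWeight_le_one x) ?_
          (Real.rpow_nonneg (mixedEmbedding.norm_nonneg x) _) zero_le_one
        exact Real.rpow_le_rpow_of_nonpos (by positivity) h1 (by linarith)
    _ = _ := by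
      rw [one_mul, ← Real.mul_rpow hc.le hx0.le, ← Real.rpow_natCast,
        ← Real.rpow_mul (by positivity)]
      ring_nf

end ConeTerm

/-! ### Cosets of the doubles in an abelian group. -/

section DoublingCosets

variable (G : Type*) [AddCommGroup G]

/-- The quotient of an additive commutative group by its doubles. -/
abbrev ModTwo : Type _ := G ⧸ (nsmulAddMonoidHom (α := G) 2).range

lemma finite_modTwo [AddGroup.FG G] : Finite (ModTwo G) := by
  have : AddGroup.FG (ModTwo G) := QuotientAddGroup.fg _
  refine AddCommGroup.finite_of_fg_isAddTorsion _ fun q ↦ ?_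
  obtain ⟨g, rfl⟩ := QuotientAddGroup.mk_surjective q
  rw [isOfFinAddOrder_iff_nsmul_eq_zero]
  refine ⟨2, two_pos, ?_⟩
  rw [← QuotientAddGroup.mk_nsmul, QuotientAddGroup.eq_zero_iff]
  exact ⟨g, rfl⟩

variable {G}

lemma bijective_two_nsmul_add_out (hG : Function.Injective fun g : G ↦ 2 • g) :
    Function.Bijective fun p : ModTwo G × G ↦ 2 • p.2 + Quotient.out p.1 := by
  have hmk : ∀ p : ModTwo G × G,
      QuotientAddGroup.mk (s := (nsmulAddMonoidHom (α := G) 2).range) (2 • p.2 + Quotient.out p.1)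
        = p.1 := fun p ↦ by
    have h0 : (QuotientAddGroup.mk (2 • p.2) : ModTwo G) = 0 :=
      (QuotientAddGroup.eq_zero_iff _).mpr (AddMonoidHom.mem_range.mpr ⟨p.2, rfl⟩)
    rw [QuotientAddGroup.mk_add, h0, zero_add]
    exact QuotientAddGroup.out_eq' _
  refine ⟨fun p q h ↦ ?_, fun g ↦ ?_⟩
  · have h1 : p.1 = q.1 := by rw [← hmk p, ← hmk q]; exact congrArg _ h
    refine Prod.ext h1 (hG ?_)
    simpa only [h1, add_left_inj] using h
  · let q : ModTwo G := QuotientAddGroup.mk g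
    have h1 : (QuotientAddGroup.mk (g - Quotient.out q) : ModTwo G) = 0 := by
      rw [QuotientAddGroup.mk_sub, sub_eq_zero]
      exact (QuotientAddGroup.out_eq' q).symm
    obtain ⟨a, ha⟩ := (QuotientAddGroup.eq_zero_iff _).mp h1
    refine ⟨(q, a), ?_⟩
    change 2 • a = g - _ at ha
    simp only [ha, sub_add_cancel]

end DoublingCosets

/-! ### Continuation of the weighted sum over an ideal. -/

section LatticeSum

open scoped Classical

open NumberField.mixedEmbedding

variable {K : Type*} [Field K] [NumberField K]

variable (K) in
/-- The embedding of the ring of integers into the mixed space. -/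
noncomputable def integerEmbedding : 𝓞 K →+* mixedSpace K :=
  (mixedEmbedding K).comp (algebraMap (𝓞 K) K)

lemma integerEmbedding_injective : Function.Injective (integerEmbedding K) :=
  (mixedEmbedding_injective K).comp RingOfIntegers.coe_injective

lemma norm_integerEmbedding (x : 𝓞 K) :
    mixedEmbedding.norm (integerEmbedding K x) = (Algebra.norm ℤ x).natAbs := by
  rw [integerEmbedding, RingHom.comp_apply, mixedEmbedding.norm_eq_norm, Nat.cast_natAbs, ← Algebra.coe_norm_int]
  push_cast
  simp

lemma norm_integerEmbedding_ne_zero {x : 𝓞 K} (hx : x ≠ 0) :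
    mixedEmbedding.norm (integerEmbedding K x) ≠ 0 := by
  rw [norm_integerEmbedding]
  simpa using hx

lemma one_le_norm_integerEmbedding {x : 𝓞 K} (hx : x ≠ 0) :
    1 ≤ mixedEmbedding.norm (integerEmbedding K x) := by
  rw [norm_integerEmbedding, Nat.one_le_cast, Nat.one_le_iff_ne_zero]
  simpa using hx

lemma coneTerm_zero {s : ℂ} (hs : s ≠ 0) : coneTerm s (0 : mixedSpace K) = 0 := by
  rw [coneTerm, map_zero, Complex.ofReal_zero, Complex.zero_cpow (neg_ne_zero.mpr hs), mul_zero]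

lemma norm_coneTerm_integer_le_one {s : ℂ} (hs : 0 < s.re) (x : 𝓞 K) :
    ‖coneTerm s (integerEmbedding K x)‖ ≤ 1 := by
  by_cases hx : x = 0
  · have hs' : s ≠ 0 := by rintro rfl; simp at hs
    rw [hx, map_zero, coneTerm_zero hs', norm_zero]
    exact zero_le_one
  · rw [norm_coneTerm (norm_integerEmbedding_ne_zero hx)]
    exact mul_le_one₀ (coneWeight_le_one _) (Real.rpow_nonneg (mixedEmbedding.norm_nonneg _) _)
      (Real.rpow_le_one_of_one_le_of_nonpos (one_le_norm_integerEmbedding hx) (by linarith))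

lemma differentiableAt_coneTerm (x : mixedSpace K) {s : ℂ} (hs : s ≠ 0) :
    DifferentiableAt ℂ (fun s ↦ coneTerm s x) s := by
  refine (differentiableAt_const _).mul ?_
  exact differentiableAt_id.neg.const_cpow (Or.inr (neg_ne_zero.mpr hs))

lemma coneTerm_two_nsmul {s : ℂ} (hs : s ≠ 0) (x : 𝓞 K) :
    coneTerm s (integerEmbedding K (2 • x : 𝓞 K)) =
      (2 : ℂ) ^ (-(Module.finrank ℚ K * s)) * coneTerm s (integerEmbedding K x) := by
  by_cases hx : x = 0
  · rw [hx, smul_zero, map_zero, coneTerm_zero hs, mul_zero]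
  · rw [← coneTerm_two_smul s (norm_integerEmbedding_ne_zero hx)]
    congr 1
    rw [map_nsmul, two_smul ℝ, two_nsmul]

variable (K) in
lemma finrank_integerLattice :
    Module.finrank ℤ (mixedEmbedding.integerLattice K) = Module.finrank ℚ K := by
  rw [ZLattice.rank ℝ, mixedEmbedding.finrank]

variable (K) in
lemma summable_norm_integerEmbedding_rpow {r : ℝ} (hr : Module.finrank ℚ K < r) :
    Summable fun x : 𝓞 K ↦ ‖integerEmbedding K x‖ ^ (-r) := by
  have h : Summable fun z : mixedEmbedding.integerLattice K ↦ ‖(z : mixedSpace K)‖ ^ (-r) := by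
    refine ZLattice.summable_norm_rpow (mixedEmbedding.integerLattice K) (-r) ?_
    rw [finrank_integerLattice]; linarith
  have hi : Function.Injective fun x : 𝓞 K ↦
      (⟨integerEmbedding K x, LinearMap.mem_range.mpr ⟨x, rfl⟩⟩ :
        mixedEmbedding.integerLattice K) := fun x y hxy ↦
    integerEmbedding_injective (Subtype.ext_iff.mp hxy)
  refine (h.comp_injective hi).congr fun x ↦ ?_
  rw [Function.comp_apply]

lemma summable_coneTerm (J : Ideal (𝓞 K)) {s : ℂ} (hs : 1 < s.re) :
    Summable fun a : J ↦ coneTerm s (integerEmbedding K (a : 𝓞 K)) := by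
  obtain ⟨C, -, hC⟩ := exists_norm_coneTerm_le K s (by linarith)
  have hd : (0 : ℝ) < Module.finrank ℚ K := Nat.cast_pos.mpr Module.finrank_pos
  have h := (summable_norm_integerEmbedding_rpow K (r := Module.finrank ℚ K * s.re)
    (lt_mul_of_one_lt_right hd hs)).mul_left C
  have h' : Summable fun x : 𝓞 K ↦ coneTerm s (integerEmbedding K x) := by
    refine Summable.of_norm_bounded h fun x ↦ ?_
    by_cases hx : x = 0
    · have hs' : s ≠ 0 := by rintro rfl; norm_num at hs
      rw [hx, map_zero, coneTerm_zero hs', norm_zero, norm_zero,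
        Real.zero_rpow, mul_zero]
      have : (0 : ℝ) < Module.finrank ℚ K * s.re := by positivity
      linarith
    · exact hC _ (norm_integerEmbedding_ne_zero hx)
  exact h'.comp_injective Subtype.val_injective

/-- Locally uniformly in `s`, the differences are `O(‖2a‖ ^ (-(dσ + 1)))`, and this exponent beats
the lattice rank `d` as soon as `σ > 1 - 1/d`. -/
lemma differentiableOn_tsum_coneTerm_sub (J : Ideal (𝓞 K)) (b : 𝓞 K) :
    DifferentiableOn ℂ (fun s ↦ ∑' a : J,
      (coneTerm s (integerEmbedding K (2 • (a : 𝓞 K) + b : 𝓞 K)) -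
        coneTerm s (integerEmbedding K (2 • (a : 𝓞 K) : 𝓞 K))))
      {s : ℂ | 1 - 1 / (Module.finrank ℚ K : ℝ) < s.re} := by
  intro s₀ (hs₀ : 1 - 1 / (Module.finrank ℚ K : ℝ) < s₀.re)
  set d := Module.finrank ℚ K with hd
  have hd0 : (0 : ℝ) < d := Nat.cast_pos.mpr Module.finrank_pos
  have hd1 : (0 : ℝ) ≤ 1 - 1 / (d : ℝ) := by
    rw [sub_nonneg, div_le_one hd0]
    exact Nat.one_le_cast.mpr Module.finrank_pos
  obtain ⟨σ, hσ1, hσ2⟩ := exists_between hs₀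
  have hσ0 : 0 ≤ σ := by linarith
  let R := ‖integerEmbedding K b‖
  obtain ⟨C, T, hC, hRT, hbound⟩ := exists_norm_coneTerm_sub_le K (σ := σ) (B := ‖s₀‖ + 1) (R := R)
    hσ0 (by positivity) (norm_nonneg _)
  have hT : 0 < T := (norm_nonneg _).trans_lt hRT
  let ρ : ℝ := d * σ + 1
  have hρ : d < ρ := by
    have : d * (1 - 1 / (d : ℝ)) < d * σ := by gcongr
    rw [mul_sub, mul_one_div_cancel hd0.ne'] at this
    simp only [ρ]; linarith
  let U : Set ℂ := {s | σ < s.re} ∩ Metric.ball 0 (‖s₀‖ + 1)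
  have hU : IsOpen U :=
    (isOpen_lt continuous_const Complex.continuous_re).inter Metric.isOpen_ball
  -- `C` handles points of norm at least `T`. For the shorter nonzero ones, `2 * T ^ ρ` absorbs the
  -- trivial bound 2. The point `a = 0` needs its own term because `0 ^ (-ρ) = 0` in Lean.
  let u : J → ℝ := fun a ↦ (C + 2 * T ^ ρ) * ‖integerEmbedding K (2 • (a : 𝓞 K) : 𝓞 K)‖ ^ (-ρ)
    + if a = 0 then 2 else 0
  have hinj : Function.Injective fun a : J ↦ (2 • (a : 𝓞 K) : 𝓞 K) := fun a b h ↦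
    Subtype.ext (smul_right_injective _ two_ne_zero h)
  have hu : Summable u := by
    refine ((((summable_norm_integerEmbedding_rpow K hρ).comp_injective hinj).mul_left _)).add ?_
    exact summable_of_hasFiniteSupport ((Set.finite_singleton (0 : J)).subset fun a ha ↦ by
      by_contra h
      exact ha (if_neg h))
  refine DifferentiableAt.differentiableWithinAt (DifferentiableOn.differentiableAt (s := U) ?_
    (hU.mem_nhds ⟨hσ2, by simp⟩))
  have hne : ∀ s ∈ U, s ≠ 0 := by
    rintro s ⟨h, -⟩ rfl
    exact absurd h (by simpa using hσ0)
  refine Complex.differentiableOn_tsum_of_summable_norm hu (fun a s hs ↦ ?_) hU fun a s hs ↦ ?_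
  · exact ((differentiableAt_coneTerm _ (hne s hs)).sub
      (differentiableAt_coneTerm _ (hne s hs))).differentiableWithinAt
  have hsre : σ < s.re := hs.1
  have h2 : ‖coneTerm s (integerEmbedding K (2 • (a : 𝓞 K) + b : 𝓞 K)) -
        coneTerm s (integerEmbedding K (2 • (a : 𝓞 K) : 𝓞 K))‖ ≤ 2 := by
    refine (norm_sub_le _ _).trans ?_
    have h3 := norm_coneTerm_integer_le_one (s := s) (by linarith) (2 • (a : 𝓞 K) + b)
    have h4 := norm_coneTerm_integer_le_one (s := s) (by linarith) (2 • (a : 𝓞 K))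
    linarith
  by_cases ha : a = 0
  · refine h2.trans ?_
    simp only [u, if_pos ha]
    exact le_add_of_nonneg_left (by positivity)
  have ha' : (2 • (a : 𝓞 K) : 𝓞 K) ≠ 0 := fun h ↦ ha (hinj (by simpa using h))
  have hnorm : 0 < ‖integerEmbedding K (2 • (a : 𝓞 K) : 𝓞 K)‖ :=
    norm_pos_iff.mpr fun h ↦ norm_integerEmbedding_ne_zero ha' (by rw [h, map_zero])
  simp only [u, if_neg ha, add_zero]
  by_cases haT : T ≤ ‖integerEmbedding K (2 • (a : 𝓞 K) : 𝓞 K)‖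
  · have hab : (2 • (a : 𝓞 K) + b : 𝓞 K) ≠ 0 := fun h ↦ by
      rw [eq_neg_of_add_eq_zero_left h, map_neg, norm_neg] at haT
      linarith
    rw [norm_sub_rev]
    refine (hbound s hsre.le (mem_ball_zero_iff.mp hs.2).le _ _ (norm_integerEmbedding_ne_zero ha')
      (norm_integerEmbedding_ne_zero hab) ?_ haT).trans ?_
    · rw [norm_sub_rev, map_add, add_sub_cancel_left]
    · exact mul_le_mul_of_nonneg_right (le_add_of_nonneg_right (by positivity)) (by positivity)
  · refine h2.trans ?_
    push Not at haT
    have h5 : 1 ≤ T ^ ρ * ‖integerEmbedding K (2 • (a : 𝓞 K) : 𝓞 K)‖ ^ (-ρ) := by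
      rw [Real.rpow_neg hnorm.le, ← div_eq_mul_inv, one_le_div (by positivity)]
      exact Real.rpow_le_rpow hnorm.le haT.le (by linarith)
    have h6 : 0 ≤ C * ‖integerEmbedding K (2 • (a : 𝓞 K) : 𝓞 K)‖ ^ (-ρ) := by positivity
    rw [add_mul, mul_assoc]
    linarith

/-- The sum of `coneTerm` over an ideal, multiplied by an elementary factor, extends
holomorphically to the half plane `1 - 1 / [K : ℚ] < re s`. -/
lemma exists_differentiableOn_eq_tsum_coneTerm_mul (J : Ideal (𝓞 K)) :
    ∃ (E : ℂ → ℂ) (k : ℕ),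
      DifferentiableOn ℂ E {s : ℂ | 1 - 1 / (Module.finrank ℚ K : ℝ) < s.re} ∧
      ∀ s : ℂ, 1 < s.re →
        (∑' a : J, coneTerm s (integerEmbedding K (a : 𝓞 K))) *
          (1 - k * (2 : ℂ) ^ (-(Module.finrank ℚ K * s))) = E s := by
  have : Module.Finite ℤ J := Module.IsNoetherian.finite ℤ (J.restrictScalars ℤ)
  have : AddGroup.FG J := Module.Finite.iff_addGroup_fg.mp inferInstance
  have : Finite (ModTwo J) := finite_modTwo J
  have := Fintype.ofFinite (ModTwo J)
  -- Summed over the cosets, the first terms rebuild the full sum `Z(s)`, while the second give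
  -- `card (J / 2J)` copies of the sum over `2J`, which is `2 ^ (-ds) Z(s)` by homogeneity.
  refine ⟨fun s ↦ ∑ q : ModTwo J, ∑' a : J,
      (coneTerm s (integerEmbedding K (2 • (a : 𝓞 K) + (Quotient.out q : J) : 𝓞 K)) -
        coneTerm s (integerEmbedding K (2 • (a : 𝓞 K) : 𝓞 K))),
    Fintype.card (ModTwo J),
    DifferentiableOn.fun_sum fun q _ ↦ differentiableOn_tsum_coneTerm_sub J _, fun s hs ↦ ?_⟩
  have hs' : s ≠ 0 := by rintro rfl; norm_num at hs
  have hsum := summable_coneTerm J hs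
  have hinj : Function.Injective fun a : J ↦ 2 • a := smul_right_injective _ two_ne_zero
  let e := Equiv.ofBijective _ (bijective_two_nsmul_add_out hinj)
  have hsum' := (e.summable_iff (f := fun a : J ↦ coneTerm s (integerEmbedding K (a : 𝓞 K)))).mpr
    hsum
  have h1 : ∀ q : ModTwo J, Summable fun a : J ↦
      coneTerm s (integerEmbedding K (2 • (a : 𝓞 K) + (Quotient.out q : J) : 𝓞 K)) :=
    fun q ↦ hsum'.prod_factor q
  have h2 : Summable fun a : J ↦ coneTerm s (integerEmbedding K (2 • (a : 𝓞 K) : 𝓞 K)) := by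
    simp only [coneTerm_two_nsmul hs']
    exact hsum.mul_left _
  have h3 : ∑' a : J, coneTerm s (integerEmbedding K (a : 𝓞 K)) = ∑ q : ModTwo J, ∑' a : J,
      coneTerm s (integerEmbedding K (2 • (a : 𝓞 K) + (Quotient.out q : J) : 𝓞 K)) := by
    rw [← e.tsum_eq, ← tsum_fintype (L := .unconditional _)]
    exact hsum'.tsum_prod
  have h4 : ∑' a : J, coneTerm s (integerEmbedding K (2 • (a : 𝓞 K) : 𝓞 K)) =
      (2 : ℂ) ^ (-(Module.finrank ℚ K * s)) *
        ∑' a : J, coneTerm s (integerEmbedding K (a : 𝓞 K)) := by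
    simp only [coneTerm_two_nsmul hs']
    exact tsum_mul_left
  have h5 := Finset.sum_congr rfl fun (q : ModTwo J) (_ : q ∈ Finset.univ) ↦ (h1 q).tsum_sub h2
  rw [Finset.sum_sub_distrib, ← h3, h4, Finset.sum_const, Finset.card_univ, nsmul_eq_mul] at h5
  refine Eq.trans ?_ h5.symm
  ring

end LatticeSum

/-! ### From lattice sums to the Dedekind zeta function and its pole. -/

lemma HasSum.of_injective_prod {α β γ : Type*} {f : γ → ℂ} {ψ : α × β → γ}
    (hψ : Function.Injective ψ) (h0 : ∀ x ∉ Set.range ψ, f x = 0) (hf : Summable f) {G : α → ℂ}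
    (hG : ∀ a, HasSum (fun b ↦ f (ψ (a, b))) (G a)) : HasSum G (∑' x, f x) :=
  ((hψ.hasSum_iff h0).mpr hf.hasSum).prod_fiberwise hG

section ClassSum

open NumberField.mixedEmbedding NumberField.Units
open scoped nonZeroDivisors

variable {K : Type*} [Field K] [NumberField K]

lemma integerEmbedding_unit_mul {K : Type*} [Field K] (u : (𝓞 K)ˣ) (x : 𝓞 K) :
    integerEmbedding K (u * x) = u • integerEmbedding K x := by
  rw [map_mul]; rfl

lemma norm_integerEmbedding_eq_absNorm (x : 𝓞 K) :
    mixedEmbedding.norm (integerEmbedding K x) = Ideal.absNorm (Ideal.span {x}) := by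
  rw [norm_integerEmbedding, Ideal.absNorm_span_singleton]


lemma hasSum_coneTerm_unit_mul {x : 𝓞 K} (hx : x ≠ 0) (s : ℂ) :
    HasSum (fun u : (𝓞 K)ˣ ↦ coneTerm s (integerEmbedding K (u * x)))
      (torsionOrder K * (Ideal.absNorm (Ideal.span {x}) : ℂ) ^ (-s)) := by
  have h := (Complex.hasSum_ofReal.mpr
    (hasSum_coneWeight_unit_smul (norm_integerEmbedding_ne_zero hx))).mul_right
      ((Ideal.absNorm (Ideal.span {x}) : ℂ) ^ (-s))
  refine h.congr_fun fun u ↦ ?_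
  rw [integerEmbedding_unit_mul, coneTerm, mixedEmbedding.norm_unit_smul,
    norm_integerEmbedding_eq_absNorm, Complex.ofReal_natCast]

lemma exists_mul_eq_span_of_mk0_eq_inv {I J : (Ideal (𝓞 K))⁰}
    (h : ClassGroup.mk0 I = (ClassGroup.mk0 J)⁻¹) :
    ∃ x : 𝓞 K, (I * J : Ideal (𝓞 K)) = Ideal.span {x} := by
  have h1 : ClassGroup.mk0 (I * J) = 1 := by rw [map_mul, h, inv_mul_cancel]
  exact ((ClassGroup.mk0_eq_one_iff (I * J).2).mp h1).principal

/-- The sum of `coneTerm` over an ideal `J` is a multiple of the zeta function of the inverse of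
the ideal class of `J`. -/
lemma hasSum_absNorm_mul_cpow_of_class (J : (Ideal (𝓞 K))⁰) {s : ℂ} (hs : 1 < s.re) :
    HasSum (fun I : {I : (Ideal (𝓞 K))⁰ // ClassGroup.mk0 I = (ClassGroup.mk0 J)⁻¹} ↦
        torsionOrder K * (Ideal.absNorm (I.1 * J : Ideal (𝓞 K)) : ℂ) ^ (-s))
      (∑' a : (J : Ideal (𝓞 K)), coneTerm s (integerEmbedding K (a : 𝓞 K))) := by
  have hs' : s ≠ 0 := by rintro rfl; norm_num at hs
  have hgen (I : {I : (Ideal (𝓞 K))⁰ // ClassGroup.mk0 I = (ClassGroup.mk0 J)⁻¹}) :=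
    exists_mul_eq_span_of_mk0_eq_inv I.2
  choose g hg using hgen
  have hg0 : ∀ I, g I ≠ 0 := fun I h ↦ by
    have h1 := hg I
    rw [h, Ideal.span_singleton_eq_bot.mpr rfl] at h1
    exact mul_ne_zero (nonZeroDivisors.coe_ne_zero I.1) (nonZeroDivisors.coe_ne_zero J) h1
  have hgJ (I) (u : (𝓞 K)ˣ) : (u : 𝓞 K) * g I ∈ (J : Ideal (𝓞 K)) := by
    have h1 : g I ∈ (I.1 * J : Ideal (𝓞 K)) := by
      rw [hg I]; exact Ideal.mem_span_singleton_self (g I)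
    exact Ideal.mul_mem_left _ _ (Ideal.mul_le_inf h1).2
  -- A nonzero `a ∈ J` generates `I * J` for a unique `I`, necessarily in the inverse class, and
  -- equals the chosen generator times a unique unit. Thus `ψ` misses only 0, and summing over the
  -- units removes the weight.
  let ψ : {I : (Ideal (𝓞 K))⁰ // ClassGroup.mk0 I = (ClassGroup.mk0 J)⁻¹} × (𝓞 K)ˣ →
      (J : Ideal (𝓞 K)) := fun p ↦ ⟨p.2 * g p.1, hgJ p.1 p.2⟩
  have hspan : ∀ p, Ideal.span {(ψ p : 𝓞 K)} = (p.1.1 * J : Ideal (𝓞 K)) := fun p ↦ by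
    rw [hg]
    exact Ideal.span_singleton_mul_left_unit p.2.isUnit _
  have hψ : Function.Injective ψ := fun p q h ↦ by
    have h1 : (p.1.1 * J : Ideal (𝓞 K)) = (q.1.1 * J : Ideal (𝓞 K)) := by
      rw [← hspan, ← hspan, h]
    have h2 : p.1 = q.1 :=
      Subtype.ext (Subtype.ext (mul_right_cancel₀ (nonZeroDivisors.coe_ne_zero J) h1))
    have h3 : (p.2 : 𝓞 K) * g p.1 = q.2 * g q.1 := Subtype.ext_iff.mp h
    rw [h2] at h3
    exact Prod.ext h2 (Units.ext (mul_right_cancel₀ (hg0 q.1) h3))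
  have hrange : ∀ a ∉ Set.range ψ, coneTerm s (integerEmbedding K (a : 𝓞 K)) = 0 := fun a ha ↦ by
    by_cases h0 : (a : 𝓞 K) = 0
    · rw [h0, map_zero, coneTerm_zero hs']
    exfalso
    apply ha
    obtain ⟨I, hI⟩ := Ideal.dvd_span_singleton.mpr a.2
    have hI0 : I ∈ (Ideal (𝓞 K))⁰ := mem_nonZeroDivisors_of_ne_zero fun h ↦ h0 (by
      rw [h, mul_zero] at hI
      exact Ideal.span_singleton_eq_bot.mp hI)
    have hcl : ClassGroup.mk0 ⟨I, hI0⟩ = (ClassGroup.mk0 J)⁻¹ := by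
      rw [eq_inv_iff_mul_eq_one, ← map_mul, ClassGroup.mk0_eq_one_iff]
      exact ⟨(a : 𝓞 K), by rw [Submonoid.coe_mul, mul_comm]; exact hI.symm⟩
    have h1 : Ideal.span {g ⟨⟨I, hI0⟩, hcl⟩} = Ideal.span {(a : 𝓞 K)} := by
      rw [← hg, hI, mul_comm]
    obtain ⟨u, hu⟩ := Ideal.span_singleton_eq_span_singleton.mp h1
    exact ⟨(⟨⟨I, hI0⟩, hcl⟩, u), Subtype.ext (by rw [← hu, mul_comm])⟩
  refine HasSum.of_injective_prod hψ hrange (summable_coneTerm (J : Ideal (𝓞 K)) hs) fun I ↦ ?_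
  rw [hg]
  exact hasSum_coneTerm_unit_mul (hg0 I) s

lemma hasSum_absNorm_cpow_of_class (J : (Ideal (𝓞 K))⁰) {s : ℂ} (hs : 1 < s.re) :
    HasSum (fun I : {I : (Ideal (𝓞 K))⁰ // ClassGroup.mk0 I = (ClassGroup.mk0 J)⁻¹} ↦
        (Ideal.absNorm (I.1 : Ideal (𝓞 K)) : ℂ) ^ (-s))
      ((Ideal.absNorm (J : Ideal (𝓞 K)) : ℂ) ^ s / torsionOrder K *
        ∑' a : (J : Ideal (𝓞 K)), coneTerm s (integerEmbedding K (a : 𝓞 K))) := by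
  have hw : (torsionOrder K : ℂ) ≠ 0 := Nat.cast_ne_zero.mpr (torsionOrder_ne_zero K)
  have hJ : (Ideal.absNorm (J : Ideal (𝓞 K)) : ℂ) ≠ 0 :=
    Nat.cast_ne_zero.mpr (Ideal.absNorm_ne_zero_of_nonZeroDivisors J)
  refine ((hasSum_absNorm_mul_cpow_of_class J hs).mul_left _).congr_fun fun I ↦ ?_
  rw [map_mul, Nat.cast_mul, Complex.natCast_mul_natCast_cpow, Complex.cpow_neg _ s,
    Complex.cpow_neg _ s]
  have : (Ideal.absNorm (J : Ideal (𝓞 K)) : ℂ) ^ s ≠ 0 := by simp [Complex.cpow_eq_zero_iff, hJ]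
  field_simp

lemma hasSum_absNorm_cpow {s : ℂ} (hs : 1 < s.re) (J : ClassGroup (𝓞 K) → (Ideal (𝓞 K))⁰)
    (hJ : ∀ c, ClassGroup.mk0 (J c) = c⁻¹) :
    HasSum (fun I : (Ideal (𝓞 K))⁰ ↦ (Ideal.absNorm (I : Ideal (𝓞 K)) : ℂ) ^ (-s))
      (∑ c, (Ideal.absNorm (J c : Ideal (𝓞 K)) : ℂ) ^ s / torsionOrder K *
        ∑' a : (J c : Ideal (𝓞 K)), coneTerm s (integerEmbedding K (a : 𝓞 K))) := by
  classical
  have h : ∀ c : ClassGroup (𝓞 K), HasSum (Set.indicator {I | ClassGroup.mk0 I = c}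
      fun I : (Ideal (𝓞 K))⁰ ↦ (Ideal.absNorm (I : Ideal (𝓞 K)) : ℂ) ^ (-s))
      ((Ideal.absNorm (J c : Ideal (𝓞 K)) : ℂ) ^ s / torsionOrder K *
        ∑' a : (J c : Ideal (𝓞 K)), coneTerm s (integerEmbedding K (a : 𝓞 K))) := fun c ↦ by
    have h1 := hasSum_absNorm_cpow_of_class (J c) hs
    rw [hJ, inv_inv] at h1
    exact hasSum_subtype_iff_indicator.mp h1
  refine (hasSum_sum fun c (_ : c ∈ Finset.univ) ↦ h c).congr_fun fun I ↦ ?_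
  simp [Set.indicator_apply]

lemma summable_absNorm_cpow (K : Type*) [Field K] [NumberField K] {s : ℂ} (hs : 1 < s.re) :
    Summable fun I : (Ideal (𝓞 K))⁰ ↦ (Ideal.absNorm (I : Ideal (𝓞 K)) : ℂ) ^ (-s) := by
  choose J hJ using fun c : ClassGroup (𝓞 K) ↦ ClassGroup.mk0_surjective c⁻¹
  exact (hasSum_absNorm_cpow hs J hJ).summable

lemma dedekindZeta_eq_tsum {s : ℂ} (hs : 1 < s.re) :
    dedekindZeta K s = ∑' I : (Ideal (𝓞 K))⁰, (Ideal.absNorm (I : Ideal (𝓞 K)) : ℂ) ^ (-s) := by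
  let F : (Ideal (𝓞 K))⁰ → ℂ := fun I ↦ (Ideal.absNorm (I : Ideal (𝓞 K)) : ℂ) ^ (-s)
  let e := Equiv.sigmaFiberEquiv fun I : (Ideal (𝓞 K))⁰ ↦ Ideal.absNorm (I : Ideal (𝓞 K))
  have h : HasSum (F ∘ e) (∑' I, F I) := e.hasSum_iff.mpr (summable_absNorm_cpow K hs).hasSum
  refine (h.sigma fun n ↦ ?_).tsum_eq
  have hF : ∀ I : {I : (Ideal (𝓞 K))⁰ // Ideal.absNorm (I : Ideal (𝓞 K)) = n},
      (F ∘ e) ⟨n, I⟩ = (n : ℂ) ^ (-s) := fun I ↦ by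
    change (Ideal.absNorm (I.1 : Ideal (𝓞 K)) : ℂ) ^ (-s) = _
    rw [I.2]
  rcases eq_or_ne n 0 with rfl | hn
  · have : IsEmpty {I : (Ideal (𝓞 K))⁰ // Ideal.absNorm (I : Ideal (𝓞 K)) = 0} :=
      ⟨fun I ↦ Ideal.absNorm_ne_zero_of_nonZeroDivisors I.1 I.2⟩
    rw [LSeries.term_zero]
    exact hasSum_empty
  let e' : {I : (Ideal (𝓞 K))⁰ // Ideal.absNorm (I : Ideal (𝓞 K)) = n} ≃
      {I : Ideal (𝓞 K) // Ideal.absNorm I = n} :=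
    { toFun := fun I ↦ ⟨I.1, I.2⟩
      invFun := fun I ↦ ⟨⟨I.1, mem_nonZeroDivisors_of_ne_zero fun h ↦ hn (by
        rw [← I.2, h]; exact Ideal.absNorm_bot)⟩, I.2⟩
      left_inv := fun _ ↦ rfl
      right_inv := fun _ ↦ rfl }
  have hfin : Finite {I : Ideal (𝓞 K) // Ideal.absNorm I = n} :=
    Ideal.finite_setOfPred_absNorm_eq n
  have : Finite {I : (Ideal (𝓞 K))⁰ // Ideal.absNorm (I : Ideal (𝓞 K)) = n} := Finite.of_equiv _ e'.symm
  have := Fintype.ofFinite {I : (Ideal (𝓞 K))⁰ // Ideal.absNorm (I : Ideal (𝓞 K)) = n}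
  have h2 := hasSum_fintype fun I : {I : (Ideal (𝓞 K))⁰ // Ideal.absNorm (I : Ideal (𝓞 K)) = n} ↦
    (F ∘ e) ⟨n, I⟩
  rw [Finset.sum_congr rfl fun I _ ↦ hF I, Finset.sum_const, Finset.card_univ,
    ← Nat.card_eq_fintype_card, Nat.card_congr e', nsmul_eq_mul, Complex.cpow_neg,
    ← div_eq_mul_inv] at h2
  rw [LSeries.term_of_ne_zero hn]
  exact h2

/-- The Dedekind zeta function extends to a meromorphic function in a neighbourhood of `1`, with a
simple pole there. -/
theorem exists_meromorphicOn_eq_dedekindZeta (K : Type*) [Field K] [NumberField K] :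
    ∃ (U : Set ℂ) (g : ℂ → ℂ), IsOpen U ∧ (1 : ℂ) ∈ U ∧ MeromorphicOn g U ∧
      (∀ s ∈ U, 1 < s.re → g s = dedekindZeta K s) ∧ meromorphicOrderAt g 1 = (-1 : ℤ) := by
  choose J hJ using fun c : ClassGroup (𝓞 K) ↦ ClassGroup.mk0_surjective c⁻¹
  choose E k hE hT using fun c ↦ exists_differentiableOn_eq_tsum_coneTerm_mul
    (J c : Ideal (𝓞 K))
  set d := Module.finrank ℚ K with hd
  have hd0 : (0 : ℝ) < d := Nat.cast_pos.mpr Module.finrank_pos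
  let V : Set ℂ := {s : ℂ | 1 - 1 / (d : ℝ) < s.re}
  have hV : IsOpen V := isOpen_lt continuous_const Complex.continuous_re
  have hV1 : (1 : ℂ) ∈ V := by
    change 1 - 1 / (d : ℝ) < (1 : ℂ).re
    rw [Complex.one_re]
    linarith [one_div_pos.mpr hd0]
  let D : ClassGroup (𝓞 K) → ℂ → ℂ := fun c s ↦ 1 - k c * (2 : ℂ) ^ (-(d * s))
  have hD : ∀ c, Differentiable ℂ (D c) := fun c ↦ by
    intro s
    refine (differentiableAt_const _).sub ((differentiableAt_const _).mul ?_)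
    exact ((differentiableAt_id.const_mul _).neg).const_cpow (Or.inl two_ne_zero)
  -- `D c` may vanish at 1, so only a punctured neighbourhood is claimed. By the identity theorem,
  -- failure would make `D c` zero everywhere; then the point 0 gives `k c = 1` and the point 1
  -- gives `2 ^ d = 1`.
  have hDne : ∀ c, ∀ᶠ s in nhdsWithin (1 : ℂ) {1}ᶜ, D c s ≠ 0 := fun c ↦ by
    refine ((hD c).analyticAt 1).eventually_eq_zero_or_eventually_ne_zero.resolve_left fun h ↦ ?_
    have h0 := ((hD c).differentiableOn.analyticOnNhd isOpen_univ).eq_of_eventuallyEq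
      (analyticOnNhd_const (v := 0)) h
    have h1 : D c 0 = 0 := congrFun h0 0
    have h2 : D c 1 = 0 := congrFun h0 1
    simp only [D, mul_zero, neg_zero, Complex.cpow_zero, mul_one, sub_eq_zero] at h1 h2
    rw [← h1, one_mul, Complex.cpow_neg, Complex.cpow_natCast] at h2
    have h3 : (2 : ℂ) ^ d = 1 := by rw [← inv_eq_one, ← h2]
    have h4 : (2 : ℕ) ^ d = 1 := by exact_mod_cast h3
    have h5 : d = 0 := by simpa using h4
    exact hd0.ne' (by rw [h5]; exact Nat.cast_zero)
  have hDne' : ∀ᶠ s in nhdsWithin (1 : ℂ) {1}ᶜ, ∀ c, D c s ≠ 0 := Filter.eventually_all.mpr hDne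
  obtain ⟨W, hW, hWo, hW1⟩ := eventually_nhds_iff.mp (eventually_nhdsWithin_iff.mp hDne')
  let g : ℂ → ℂ := fun s ↦ ∑ c, (Ideal.absNorm (J c : Ideal (𝓞 K)) : ℂ) ^ s /
    Units.torsionOrder K * (E c s / D c s)
  have hg : MeromorphicOn g (V ∩ W) := by
    intro s hs
    refine MeromorphicAt.fun_sum fun c _ ↦ ?_
    refine MeromorphicAt.fun_mul ?_ (MeromorphicAt.fun_div ?_ ((hD c).analyticAt s).meromorphicAt)
    · refine AnalyticAt.meromorphicAt (Differentiable.analyticAt (fun s ↦ ?_) s)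
      refine DifferentiableAt.div_const (differentiableAt_id.const_cpow (Or.inl ?_)) _
      exact Nat.cast_ne_zero.mpr (Ideal.absNorm_ne_zero_of_nonZeroDivisors (J c))
    · exact ((hE c).analyticAt (hV.mem_nhds hs.1)).meromorphicAt
  have heq : ∀ s ∈ V ∩ W, 1 < s.re → g s = dedekindZeta K s := fun s hs hre ↦ by
    rw [dedekindZeta_eq_tsum hre, (hasSum_absNorm_cpow hre J hJ).tsum_eq]
    refine Finset.sum_congr rfl fun c _ ↦ ?_
    have hs1 : s ≠ 1 := by rintro rfl; simp at hre
    rw [← hT c s hre, mul_div_cancel_right₀ _ (hW s hs.2 hs1 c)]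
  refine ⟨V ∩ W, g, hV.inter hWo, ⟨hV1, hW1⟩, hg, heq, ?_⟩
  have hg1 := hg 1 ⟨hV1, hW1⟩
  -- Along reals decreasing to 1, `G` tends to the residue, which is finite and nonzero. A negative
  -- order would make it unbounded and a positive order would give limit 0, so `G` has order 0.
  let G : ℂ → ℂ := fun s ↦ (s - 1) * g s
  have hsub : MeromorphicAt (fun s : ℂ ↦ s - 1) 1 := by fun_prop
  have hG : MeromorphicAt G 1 := hsub.mul hg1
  have hlim : Filter.Tendsto (fun t : ℝ ↦ G t) (nhdsWithin 1 (Set.Ioi 1))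
      (nhds (dedekindZeta_residue K)) := by
    refine (tendsto_sub_one_mul_dedekindZeta_nhdsGT K).congr' ?_
    have hmem : ∀ᶠ t : ℝ in nhdsWithin 1 (Set.Ioi 1), (t : ℂ) ∈ V ∩ W := by
      refine (Complex.continuous_ofReal.tendsto' 1 1 Complex.ofReal_one).mono_left
        nhdsWithin_le_nhds ((hV.inter hWo).mem_nhds ⟨hV1, hW1⟩)
    filter_upwards [hmem, self_mem_nhdsWithin] with t ht ht1
    simp only [G]
    rw [heq t ht (by simpa using ht1)]
  have hto : Filter.Tendsto (fun t : ℝ ↦ (t : ℂ)) (nhdsWithin 1 (Set.Ioi 1))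
      (nhdsWithin 1 {1}ᶜ) := by
    refine tendsto_nhdsWithin_iff.mpr ⟨(Complex.continuous_ofReal.tendsto' 1 1
      Complex.ofReal_one).mono_left nhdsWithin_le_nhds, ?_⟩
    filter_upwards [self_mem_nhdsWithin] with t (ht : 1 < t)
    simpa using ht.ne'
  have hres : (dedekindZeta_residue K : ℂ) ≠ 0 :=
    Complex.ofReal_ne_zero.mpr (dedekindZeta_residue_ne_zero K)
  have hG0 : meromorphicOrderAt G 1 = 0 := by
    rcases lt_trichotomy (meromorphicOrderAt G 1) 0 with h | h | h
    · have h1 := (tendsto_cobounded_of_meromorphicOrderAt_neg h).comp hto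
      exact absurd hlim (Filter.Tendsto.not_tendsto h1 (Metric.disjoint_cobounded_nhds _))
    · exact h
    · have h1 := (tendsto_zero_of_meromorphicOrderAt_pos h).comp hto
      exact absurd (tendsto_nhds_unique hlim h1) hres
  have hsub1 : meromorphicOrderAt (fun s : ℂ ↦ s - 1) 1 = (1 : ℤ) := by
    rw [meromorphicOrderAt_eq_int_iff hsub]
    exact ⟨fun _ ↦ 1, analyticAt_const, one_ne_zero, by simp⟩
  have hmul := meromorphicOrderAt_mul hsub hg1
  rw [hsub1] at hmul
  have hG0' : (0 : WithTop ℤ) = (1 : ℤ) + meromorphicOrderAt g 1 := by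
    rw [← hmul, ← hG0]; rfl
  cases h : meromorphicOrderAt g 1 with
  | top => rw [h] at hG0'; simp at hG0'
  | coe n =>
    rw [h] at hG0'
    have : (0 : ℤ) = 1 + n := by exact_mod_cast hG0'
    congr 1
    lia

end ClassSum

/-! ### Euler products over a free commutative monoid. -/

section FinsuppEulerProduct

variable {ι : Type*}

lemma HasSum.mul_of_summable_norm {α β : Type*} {f : α → ℂ} {g : β → ℂ} {a b : ℂ}
    (hf : HasSum f a) (hg : HasSum g b) (hf' : Summable fun x ↦ ‖f x‖)
    (hg' : Summable fun x ↦ ‖g x‖) : HasSum (fun p : α × β ↦ f p.1 * g p.2) (a * b) :=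
  hf.mul hg (summable_mul_of_summable_norm hf' hg')

lemma summable_norm_mul {α β : Type*} {f : α → ℂ} {g : β → ℂ}
    (hf : Summable fun x ↦ ‖f x‖) (hg : Summable fun x ↦ ‖g x‖) :
    Summable fun p : α × β ↦ ‖f p.1 * g p.2‖ := by
  simp only [norm_mul]
  exact hf.mul_of_nonneg hg (fun _ ↦ norm_nonneg _) (fun _ ↦ norm_nonneg _)

/-- Adjoining one index to `S` multiplies by one geometric series. Absolute summability is carried
through the induction because multiplying the two series requires it. -/
lemma hasSum_finsupp_prod_pow_of_support_subset {x : ι → ℂ} (hx : ∀ i, ‖x i‖ < 1)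
    (S : Finset ι) :
    Summable (fun v : {v : ι →₀ ℕ // v.support ⊆ S} ↦ ‖v.1.prod fun i k ↦ x i ^ k‖) ∧
    HasSum (fun v : {v : ι →₀ ℕ // v.support ⊆ S} ↦ v.1.prod fun i k ↦ x i ^ k)
      (∏ i ∈ S, (1 - x i)⁻¹) := by
  classical
  induction S using Finset.induction_on with
  | empty =>
    have : Unique {v : ι →₀ ℕ // v.support ⊆ (∅ : Finset ι)} :=
      { default := ⟨0, by simp⟩
        uniq := fun v ↦ Subtype.ext (by simpa using v.2) }
    refine ⟨Summable.of_finite, ?_⟩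
    convert hasSum_unique _
    rw [show (default : {v : ι →₀ ℕ // v.support ⊆ (∅ : Finset ι)}).1 = 0 by
      simpa using (default : {v : ι →₀ ℕ // v.support ⊆ (∅ : Finset ι)}).2]
    simp
  | insert a S ha ih =>
    let e : ℕ × {v : ι →₀ ℕ // v.support ⊆ S} ≃ {v : ι →₀ ℕ // v.support ⊆ insert a S} :=
      { toFun := fun p ↦ ⟨p.2.1 + Finsupp.single a p.1, by
          refine Finsupp.support_add.trans (Finset.union_subset
            (p.2.2.trans (Finset.subset_insert _ _)) ?_)
          exact Finsupp.support_single_subset.trans (by simp)⟩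
        invFun := fun w ↦ (w.1 a, ⟨w.1.erase a, by
          rw [Finsupp.support_erase]
          exact Finset.subset_insert_iff.mp w.2⟩)
        left_inv := fun p ↦ by
          have h0 : p.2.1 a = 0 := Finsupp.notMem_support_iff.mp fun h ↦ ha (p.2.2 h)
          refine Prod.ext (by simp [h0]) (Subtype.ext ?_)
          change (p.2.1 + Finsupp.single a p.1).erase a = p.2.1
          rw [Finsupp.erase_add, Finsupp.erase_single, add_zero,
            Finsupp.erase_of_notMem_support fun h ↦ ha (p.2.2 h)]
        right_inv := fun w ↦ Subtype.ext (Finsupp.erase_add_single a w.1) }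
    have he : ∀ p, ((e p).1.prod fun i k ↦ x i ^ k) =
        x a ^ p.1 * p.2.1.prod fun i k ↦ x i ^ k := fun p ↦ by
      change (p.2.1 + Finsupp.single a p.1).prod (fun i k ↦ x i ^ k) = _
      rw [Finsupp.prod_add_index' (fun _ ↦ pow_zero _) (fun _ _ _ ↦ pow_add _ _ _), mul_comm]
      congr 1
      exact Finsupp.prod_single_index (h := fun i k ↦ x i ^ k) (pow_zero _)
    have hgeom : Summable fun n : ℕ ↦ ‖x a ^ n‖ := by
      simp only [norm_pow]
      exact summable_geometric_of_lt_one (norm_nonneg _) (hx a)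
    constructor
    · rw [← e.summable_iff]
      refine (summable_norm_mul hgeom ih.1).congr fun p ↦ ?_
      rw [Function.comp_apply, he]
    · rw [← e.hasSum_iff, Finset.prod_insert ha]
      refine ((hasSum_geometric_of_norm_lt_one (hx a)).mul_of_summable_norm ih.2
        hgeom ih.1).congr_fun fun p ↦ ?_
      rw [Function.comp_apply, he]

/-- An abstract Euler product, over the free commutative monoid on `ι`. -/
lemma hasProd_one_sub_inv {x : ι → ℂ} (hx : ∀ i, ‖x i‖ < 1)
    (hs : Summable fun v : ι →₀ ℕ ↦ v.prod fun i k ↦ x i ^ k) :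
    HasProd (fun i ↦ (1 - x i)⁻¹) (∑' v : ι →₀ ℕ, v.prod fun i k ↦ x i ^ k) := by
  classical
  let F : (ι →₀ ℕ) → ℂ := fun v ↦ v.prod fun i k ↦ x i ^ k
  have h1 (S : Finset ι) : ∏ i ∈ S, (1 - x i)⁻¹ =
      ∑' v, Set.indicator {v : ι →₀ ℕ | v.support ⊆ S} F v := by
    have h := (hasSum_finsupp_prod_pow_of_support_subset hx S).2
    exact ((hasSum_subtype_iff_indicator (f := F)
      (s := {v : ι →₀ ℕ | v.support ⊆ S})).mp h).tsum_eq.symm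
  rw [HasProd, SummationFilter.unconditional_filter]
  simp only [h1]
  -- The partial product over `S` is the sum over exponents supported in `S`. Each `v` is eventually
  -- included, and the full series dominates.
  refine tendsto_tsum_of_dominated_convergence hs.norm (fun v ↦ ?_)
    (Filter.Eventually.of_forall fun S v ↦ norm_indicator_le_norm_self _ _)
  refine tendsto_const_nhds.congr' ?_
  filter_upwards [Filter.eventually_ge_atTop v.support] with S hS
  exact (Set.indicator_of_mem (s := {v : ι →₀ ℕ | v.support ⊆ S}) hS F).symm

end FinsuppEulerProduct

/-! ### Nonzero ideals as a free monoid on the primes. -/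

section IdealFactorization

open scoped nonZeroDivisors

variable {R : Type*} [CommRing R] [IsDedekindDomain R]

lemma finsupp_prod_asIdeal_ne_zero (v : HeightOneSpectrum R →₀ ℕ) :
    (v.prod fun P k ↦ P.asIdeal ^ k) ≠ 0 :=
  Finset.prod_ne_zero_iff.mpr fun P _ ↦ pow_ne_zero _ P.ne_bot

lemma finsupp_prod_asIdeal_injective :
    Function.Injective fun v : HeightOneSpectrum R →₀ ℕ ↦ v.prod fun P k ↦ P.asIdeal ^ k := by
  classical
  intro v w h
  have key : ∀ v : HeightOneSpectrum R →₀ ℕ, UniqueFactorizationMonoid.normalizedFactors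
      (v.prod fun P k ↦ P.asIdeal ^ k) = v.toMultiset.map HeightOneSpectrum.asIdeal := fun v ↦ by
    rw [← UniqueFactorizationMonoid.normalizedFactors_prod_of_prime
      (m := v.toMultiset.map HeightOneSpectrum.asIdeal), Finsupp.toMultiset_map,
      Finsupp.prod_toMultiset, Finsupp.prod_mapDomain_index (fun _ ↦ pow_zero _)
        (fun _ _ _ ↦ pow_add _ _ _)]
    intro p hp
    obtain ⟨P, -, rfl⟩ := Multiset.mem_map.mp hp
    exact P.prime
  have h1 := key v
  rw [show (v.prod fun P k ↦ P.asIdeal ^ k) = w.prod fun P k ↦ P.asIdeal ^ k from h, key w] at h1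
  have hinj : Function.Injective (HeightOneSpectrum.asIdeal (R := R)) := fun _ _ ↦
    HeightOneSpectrum.ext
  rw [← Finsupp.toMultiset_toFinsupp v, ← Multiset.map_injective hinj h1,
    Finsupp.toMultiset_toFinsupp]

lemma exists_finsupp_prod_asIdeal_eq {I : Ideal R} (hI : I ≠ 0) :
    ∃ v : HeightOneSpectrum R →₀ ℕ, (v.prod fun P k ↦ P.asIdeal ^ k) = I := by
  classical
  induction I using UniqueFactorizationMonoid.induction_on_prime with
  | h₁ => exact absurd rfl hI
  | h₂ I h => exact ⟨0, by rw [Finsupp.prod_zero_index]; exact (isUnit_iff_eq_one.mp h).symm⟩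
  | h₃ I p hI0 hp ih =>
    obtain ⟨v, hv⟩ := ih hI0
    refine ⟨Finsupp.single ⟨p, Ideal.isPrime_of_prime hp, hp.ne_zero⟩ 1 + v, ?_⟩
    rw [Finsupp.prod_add_index' (fun _ ↦ pow_zero _) (fun _ _ _ ↦ pow_add _ _ _), hv]
    congr 1
    refine (Finsupp.prod_single_index (h := fun (P : HeightOneSpectrum R) k ↦ P.asIdeal ^ k)
      (pow_zero _)).trans (pow_one _)

/-- Unique factorization of nonzero ideals. -/
noncomputable def finsuppEquivNonzeroIdeal : (HeightOneSpectrum R →₀ ℕ) ≃ (Ideal R)⁰ :=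
  Equiv.ofBijective (fun v ↦ ⟨v.prod fun P k ↦ P.asIdeal ^ k,
      mem_nonZeroDivisors_of_ne_zero (finsupp_prod_asIdeal_ne_zero v)⟩)
    ⟨fun _ _ h ↦ finsupp_prod_asIdeal_injective (Subtype.ext_iff.mp h), fun I ↦
      (exists_finsupp_prod_asIdeal_eq (nonZeroDivisors.coe_ne_zero I)).imp fun _ h ↦
        Subtype.ext h⟩

end IdealFactorization

/-! ### Zeta functions as exponentials of sums over primes. -/

section DedekindEulerProduct

open scoped nonZeroDivisors

variable {K : Type*} [Field K] [NumberField K]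

lemma two_le_absNorm (P : HeightOneSpectrum (𝓞 K)) : 2 ≤ Ideal.absNorm P.asIdeal := by
  have h0 : Ideal.absNorm P.asIdeal ≠ 0 := fun h ↦ P.ne_bot (Ideal.absNorm_eq_zero_iff.mp h)
  have h1 : Ideal.absNorm P.asIdeal ≠ 1 := fun h ↦
    P.isPrime.ne_top (Ideal.absNorm_eq_one_iff.mp h)
  lia

lemma norm_absNorm_cpow (P : HeightOneSpectrum (𝓞 K)) (s : ℂ) :
    ‖(Ideal.absNorm P.asIdeal : ℂ) ^ (-s)‖ = (Ideal.absNorm P.asIdeal : ℝ) ^ (-s.re) := by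
  rw [Complex.norm_natCast_cpow_of_pos (by linarith [two_le_absNorm P]), Complex.neg_re]

lemma norm_absNorm_cpow_lt_one (P : HeightOneSpectrum (𝓞 K)) {s : ℂ} (hs : 0 < s.re) :
    ‖(Ideal.absNorm P.asIdeal : ℂ) ^ (-s)‖ < 1 := by
  rw [norm_absNorm_cpow]
  have : (2 : ℝ) ≤ Ideal.absNorm P.asIdeal := by exact_mod_cast two_le_absNorm P
  exact Real.rpow_lt_one_of_one_lt_of_neg (by linarith) (by linarith)

/-- The logarithm of the Euler factor at `P`. -/
noncomputable def logEulerFactor (P : HeightOneSpectrum (𝓞 K)) (s : ℂ) : ℂ :=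
  -Complex.log (1 - (Ideal.absNorm P.asIdeal : ℂ) ^ (-s))

lemma one_sub_mem_slitPlane {z : ℂ} (hz : ‖z‖ < 1) : 1 - z ∈ Complex.slitPlane := by
  have h := Complex.mem_slitPlane_of_norm_lt_one (z := -z) (by rwa [norm_neg])
  rwa [← sub_eq_add_neg] at h

lemma log_eulerFactor (P : HeightOneSpectrum (𝓞 K)) {s : ℂ} (hs : 0 < s.re) :
    Complex.log ((1 - (Ideal.absNorm P.asIdeal : ℂ) ^ (-s))⁻¹) = logEulerFactor P s := by
  rw [Complex.log_inv _ (Complex.slitPlane_arg_ne_pi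
    (one_sub_mem_slitPlane (norm_absNorm_cpow_lt_one P hs))), logEulerFactor]

lemma differentiableAt_logEulerFactor (P : HeightOneSpectrum (𝓞 K)) {s : ℂ} (hs : 0 < s.re) :
    DifferentiableAt ℂ (logEulerFactor P) s := by
  refine DifferentiableAt.neg (DifferentiableAt.clog (f := fun s ↦ 1 - (Ideal.absNorm P.asIdeal : ℂ) ^ (-s)) ?_
    (one_sub_mem_slitPlane (norm_absNorm_cpow_lt_one P hs)))
  refine (differentiableAt_const _).sub (differentiableAt_id.neg.const_cpow (Or.inl ?_))
  exact Nat.cast_ne_zero.mpr (by linarith [two_le_absNorm P])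

lemma summable_absNorm_prime_cpow (K : Type*) [Field K] [NumberField K] {s : ℂ} (hs : 1 < s.re) :
    Summable fun P : HeightOneSpectrum (𝓞 K) ↦ (Ideal.absNorm P.asIdeal : ℂ) ^ (-s) := by
  have hinj : Function.Injective fun P : HeightOneSpectrum (𝓞 K) ↦
      (⟨P.asIdeal, mem_nonZeroDivisors_of_ne_zero P.ne_bot⟩ : (Ideal (𝓞 K))⁰) := fun P Q h ↦
    HeightOneSpectrum.ext (Subtype.ext_iff.mp h)
  refine ((summable_absNorm_cpow K hs).comp_injective hinj).congr fun P ↦ ?_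
  rw [Function.comp_apply]

lemma summable_absNorm_prime_rpow (K : Type*) [Field K] [NumberField K] {σ : ℝ} (hσ : 1 < σ) :
    Summable fun P : HeightOneSpectrum (𝓞 K) ↦ (Ideal.absNorm P.asIdeal : ℝ) ^ (-σ) := by
  refine (summable_absNorm_prime_cpow K (s := σ) (by simpa using hσ)).norm.congr fun P ↦ ?_
  rw [norm_absNorm_cpow, Complex.ofReal_re]

lemma summable_logEulerFactor (K : Type*) [Field K] [NumberField K] {s : ℂ} (hs : 1 < s.re) :
    Summable fun P : HeightOneSpectrum (𝓞 K) ↦ logEulerFactor P s := by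
  refine (Complex.summable_log_one_add_of_summable
    (summable_absNorm_prime_cpow K hs).neg).neg.congr fun P ↦ ?_
  rw [logEulerFactor, sub_eq_add_neg]

lemma partialDedekindZeta_eq_exp (A : Set (HeightOneSpectrum (𝓞 K))) {s : ℂ} (hs : 1 < s.re) :
    partialDedekindZeta A s = Complex.exp (∑' P : A, logEulerFactor P.1 s) := by
  have hs0 : 0 < s.re := by linarith
  simp only [← log_eulerFactor _ hs0]
  rw [Complex.cexp_tsum_eq_tprod]
  · simp only [partialDedekindZeta, Complex.cpow_neg, one_div]
  · intro P
    exact inv_ne_zero (Complex.slitPlane_ne_zero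
      (one_sub_mem_slitPlane (norm_absNorm_cpow_lt_one P.1 hs0)))
  · simp only [log_eulerFactor _ hs0]
    exact (summable_logEulerFactor K hs).comp_injective Subtype.val_injective

lemma finsupp_prod_absNorm_cpow (s : ℂ) (v : HeightOneSpectrum (𝓞 K) →₀ ℕ) :
    (v.prod fun P k ↦ ((Ideal.absNorm P.asIdeal : ℂ) ^ (-s)) ^ k) =
      (Ideal.absNorm ((finsuppEquivNonzeroIdeal v : (Ideal (𝓞 K))⁰) : Ideal (𝓞 K)) : ℂ) ^ (-s) := by
  let φ : Ideal (𝓞 K) →* ℂ :=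
    { toFun := fun I ↦ (Ideal.absNorm I : ℂ) ^ (-s)
      map_one' := by simp
      map_mul' := fun I J ↦ by
        rw [map_mul, Nat.cast_mul, Complex.natCast_mul_natCast_cpow] }
  change _ = φ (v.prod fun P k ↦ P.asIdeal ^ k)
  rw [map_finsuppProd]
  exact Finsupp.prod_congr fun P _ ↦ (map_pow φ _ _).symm

/-- The Euler product of the Dedekind zeta function. -/
theorem dedekindZeta_eq_exp {s : ℂ} (hs : 1 < s.re) :
    dedekindZeta K s = Complex.exp (∑' P : HeightOneSpectrum (𝓞 K), logEulerFactor P s) := by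
  have hs0 : 0 < s.re := by linarith
  have h1 := (finsuppEquivNonzeroIdeal (R := 𝓞 K)).summable_iff.mpr (summable_absNorm_cpow K hs)
  have h2 := hasProd_one_sub_inv (fun P : HeightOneSpectrum (𝓞 K) ↦ norm_absNorm_cpow_lt_one P hs0)
    (h1.congr fun v ↦ (finsupp_prod_absNorm_cpow s v).symm)
  have h3 : ∑' v : HeightOneSpectrum (𝓞 K) →₀ ℕ,
      (v.prod fun P k ↦ ((Ideal.absNorm P.asIdeal : ℂ) ^ (-s)) ^ k) = dedekindZeta K s := by
    rw [dedekindZeta_eq_tsum hs, ← (finsuppEquivNonzeroIdeal (R := 𝓞 K)).tsum_eq]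
    exact tsum_congr fun v ↦ finsupp_prod_absNorm_cpow s v
  rw [← h3, ← h2.tprod_eq]
  simp only [← log_eulerFactor _ hs0]
  rw [Complex.cexp_tsum_eq_tprod]
  · intro P
    exact inv_ne_zero (Complex.slitPlane_ne_zero
      (one_sub_mem_slitPlane (norm_absNorm_cpow_lt_one P hs0)))
  · simp only [log_eulerFactor _ hs0]
    exact summable_logEulerFactor K hs

end DedekindEulerProduct

/-! ### Decomposition of primes in the splitting field. -/

lemma splits_map_ringOfIntegers {K L : Type*} [Field K] [Field L] [NumberField L] [Algebra K L]
    {f : (𝓞 K)[X]} (hf : f.Monic)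
    (hL : IsSplittingField K L (f.map (algebraMap (𝓞 K) K))) :
    (f.map (algebraMap (𝓞 K) (𝓞 L))).Splits := by
  have h := hL.splits
  rw [Polynomial.map_map, ← IsScalarTower.algebraMap_eq] at h
  refine Splits.of_splits_map_of_injective (i := algebraMap (𝓞 L) L)
    (FaithfulSMul.algebraMap_injective _ _) ?_ fun a ha ↦ ?_
  · rwa [Polynomial.map_map, ← IsScalarTower.algebraMap_eq]
  · have hint : IsIntegral (𝓞 L) a :=
      ⟨_, hf.map (algebraMap (𝓞 K) (𝓞 L)), by
        rw [← eval_map]; exact isRoot_of_mem_roots ha⟩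
    obtain ⟨y, hy⟩ := IsIntegrallyClosed.isIntegral_iff.mp hint
    exact ⟨y, hy⟩

section RelativePrimes

open scoped Pointwise

variable {K L : Type*} [Field K] [NumberField K] [Field L] [NumberField L] [Algebra K L]

lemma absNorm_eq_absNorm_under_pow (P : HeightOneSpectrum (𝓞 L)) :
    ∃ k : ℕ, k ≠ 0 ∧
      k = Ideal.inertiaDeg' (P.under (𝓞 K)).asIdeal P.asIdeal ∧
      Ideal.absNorm P.asIdeal = Ideal.absNorm (P.under (𝓞 K)).asIdeal ^ k := by
  have : P.asIdeal.LiesOver (P.under (𝓞 K)).asIdeal := ⟨rfl⟩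
  have : (P.under (𝓞 K)).asIdeal.IsMaximal := (P.under (𝓞 K)).isMaximal
  exact ⟨_, Ideal.inertiaDeg'_ne_zero _ _, rfl,
    Ideal.absNorm_eq_pow_inertiaDeg'_of_liesOver _ _ (P.under (𝓞 K)).isPrime (P.under (𝓞 K)).ne_bot⟩

/-- The primes above `p`, as ideals and as points of the height one spectrum. -/
noncomputable def fiberUnderEquiv (p : HeightOneSpectrum (𝓞 K)) :
    {P : HeightOneSpectrum (𝓞 L) // P.under (𝓞 K) = p} ≃
      (IsDedekindDomain.primesOverFinset p.asIdeal (𝓞 L)) where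
  toFun P := ⟨P.1.asIdeal, by
    have := p.isMaximal
    rw [IsDedekindDomain.mem_primesOverFinset_iff p.ne_bot]
    exact ⟨P.1.isPrime, ⟨(congrArg HeightOneSpectrum.asIdeal P.2).symm⟩⟩⟩
  invFun Q :=
    have := p.isMaximal
    have hQ := (IsDedekindDomain.mem_primesOverFinset_iff p.ne_bot (𝓞 L)).mp Q.2
    ⟨⟨Q.1, hQ.1, Ideal.ne_bot_of_mem_primesOver p.ne_bot hQ⟩,
      HeightOneSpectrum.ext hQ.2.over.symm⟩
  left_inv _ := rfl
  right_inv _ := rfl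

instance finite_fiber_under (p : HeightOneSpectrum (𝓞 K)) :
    Finite {P : HeightOneSpectrum (𝓞 L) // P.under (𝓞 K) = p} :=
  (fiberUnderEquiv p).finite_iff.mpr inferInstance

lemma card_fiber_under (p : HeightOneSpectrum (𝓞 K)) :
    Nat.card {P : HeightOneSpectrum (𝓞 L) // P.under (𝓞 K) = p} =
      (IsDedekindDomain.primesOverFinset p.asIdeal (𝓞 L)).card := by
  rw [Nat.card_congr (fiberUnderEquiv p), Nat.card_eq_fintype_card, Fintype.card_coe]

lemma one_le_ramificationIdx_mul_inertiaDeg (p : HeightOneSpectrum (𝓞 K)) {Q : Ideal (𝓞 L)}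
    (hQ : Q ∈ IsDedekindDomain.primesOverFinset p.asIdeal (𝓞 L)) :
    1 ≤ Ideal.ramificationIdx' p.asIdeal Q * Ideal.inertiaDeg' p.asIdeal Q := by
  have := p.isMaximal
  have : Q.IsPrime := ((IsDedekindDomain.mem_primesOverFinset_iff p.ne_bot _).mp hQ).1
  have : Q.LiesOver p.asIdeal :=
    ((IsDedekindDomain.mem_primesOverFinset_iff p.ne_bot _).mp hQ).2
  exact Right.one_le_mul
    (Nat.pos_iff_ne_zero.mpr <| Ideal.IsDedekindDomain.ramificationIdx'_ne_zero_of_liesOver _ p.ne_bot)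
    (Nat.pos_iff_ne_zero.mpr <| Ideal.inertiaDeg'_ne_zero _ Q)

set_option linter.deprecated false in
lemma card_fiber_under_le (p : HeightOneSpectrum (𝓞 K)) :
    Nat.card {P : HeightOneSpectrum (𝓞 L) // P.under (𝓞 K) = p} ≤ Module.finrank K L := by
  have := p.isMaximal
  rw [card_fiber_under, ← Ideal.sum_ramification_inertia (𝓞 L) K L p.ne_bot,
    Finset.card_eq_sum_ones]
  exact Finset.sum_le_sum fun Q hQ ↦ one_le_ramificationIdx_mul_inertiaDeg p hQ

set_option linter.deprecated false in
/-- A completely decomposed prime has inertia degree one. -/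
lemma absNorm_eq_absNorm_under_of_card_fiber (P : HeightOneSpectrum (𝓞 L))
    (h : Nat.card {Q : HeightOneSpectrum (𝓞 L) // Q.under (𝓞 K) = P.under (𝓞 K)} =
      Module.finrank K L) :
    Ideal.absNorm P.asIdeal = Ideal.absNorm (P.under (𝓞 K)).asIdeal := by
  obtain ⟨k, hk0, hk, hN⟩ := absNorm_eq_absNorm_under_pow (K := K) P
  set p := P.under (𝓞 K) with hp
  have := p.isMaximal
  rw [card_fiber_under] at h
  -- In `∑ e f = [L : K]` every summand is at least 1 and there are `[L : K]` of them, so each `e f`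
  -- is 1.
  have heq := (Finset.sum_eq_sum_iff_of_le fun Q hQ ↦
    one_le_ramificationIdx_mul_inertiaDeg (L := L) p hQ).mp (by
    rw [Ideal.sum_ramification_inertia (𝓞 L) K L p.ne_bot, Finset.sum_const, smul_eq_mul,
      mul_one, h])
  have h1 := heq P.asIdeal ((fiberUnderEquiv p) ⟨P, rfl⟩).2
  rw [hN, hk, Nat.eq_one_of_mul_eq_one_left h1.symm, pow_one]

/-- A polynomial that splits over `𝓞 L` splits modulo `p` if the residue field does not grow. -/
lemma under_mem_splittingPrimes_of_absNorm_eq {f : (𝓞 K)[X]}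
    (hf : (f.map (algebraMap (𝓞 K) (𝓞 L))).Splits) (P : HeightOneSpectrum (𝓞 L))
    (hP : Ideal.absNorm P.asIdeal = Ideal.absNorm (P.under (𝓞 K)).asIdeal) :
    P.under (𝓞 K) ∈ splittingPrimes f := by
  set p := P.under (𝓞 K) with hp
  have := p.isPrime
  have := P.isPrime
  have hcomap : p.asIdeal = P.asIdeal.comap (algebraMap (𝓞 K) (𝓞 L)) := rfl
  let i : 𝓞 K ⧸ p.asIdeal →+* 𝓞 L ⧸ P.asIdeal :=
    Ideal.quotientMap P.asIdeal (algebraMap (𝓞 K) (𝓞 L)) hcomap.le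
  have hi : Function.Injective i := Ideal.quotientMap_injective' hcomap.ge
  have : Finite (𝓞 L ⧸ P.asIdeal) := Ideal.finiteQuotientOfFreeOfNeBot _ P.ne_bot
  have : Finite (𝓞 K ⧸ p.asIdeal) := Ideal.finiteQuotientOfFreeOfNeBot _ p.ne_bot
  have hb : Function.Bijective i := (Nat.bijective_iff_injective_and_card i).mpr ⟨hi, by
    rw [Ideal.absNorm_apply, Ideal.absNorm_apply, Submodule.cardQuot_apply,
      Submodule.cardQuot_apply] at hP
    exact hP.symm⟩
  refine Splits.of_splits_map_of_injective (i := i) hi ?_ fun a _ ↦ hb.2 a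
  have h := hf.map (Ideal.Quotient.mk P.asIdeal)
  rw [Polynomial.map_map] at h ⊢
  rwa [show i.comp (Ideal.Quotient.mk p.asIdeal) =
    (Ideal.Quotient.mk P.asIdeal).comp (algebraMap (𝓞 K) (𝓞 L)) from Ideal.quotientMap_comp_mk _]

/-- Residue degree 1 would make the residue fields equal and transport the splitting of `f` over `𝓞
L` down to `p`; hence the degree is at least 2. -/
lemma absNorm_under_sq_le {f : (𝓞 K)[X]}
    (hf : (f.map (algebraMap (𝓞 K) (𝓞 L))).Splits) (P : HeightOneSpectrum (𝓞 L))
    (hP : P.under (𝓞 K) ∉ splittingPrimes f) :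
    Ideal.absNorm (P.under (𝓞 K)).asIdeal ^ 2 ≤ Ideal.absNorm P.asIdeal := by
  obtain ⟨k, hk0, -, hN⟩ := absNorm_eq_absNorm_under_pow (K := K) P
  have hk1 : k ≠ 1 := fun h ↦ hP (under_mem_splittingPrimes_of_absNorm_eq hf P
    (by rw [hN, h, pow_one]))
  rw [hN]
  exact Nat.pow_le_pow_right (by linarith [two_le_absNorm (P.under (𝓞 K))]) (by lia)

/-- An automorphism in the decomposition group of `P` is trivial if `f` splits modulo the prime
below `P` and the roots of `f` stay distinct modulo `P`. -/
lemma eq_one_of_smul_eq [IsGalois K L] {f : (𝓞 K)[X]} (hf : f.Monic)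
    (hL : IsSplittingField K L (f.map (algebraMap (𝓞 K) K))) (P : HeightOneSpectrum (𝓞 L))
    (hP : P.under (𝓞 K) ∈ splittingPrimes f)
    (hdist : ∀ x ∈ (f.map (algebraMap (𝓞 K) (𝓞 L))).roots,
      ∀ y ∈ (f.map (algebraMap (𝓞 K) (𝓞 L))).roots, x - y ∈ P.asIdeal → x = y)
    (σ : Gal(L/K)) (hσ : σ • P.asIdeal = P.asIdeal) : σ = 1 := by
  set F := f.map (algebraMap (𝓞 K) (𝓞 L)) with hF
  have hF0 : F ≠ 0 := (hf.map _).ne_zero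
  set p := P.under (𝓞 K) with hp
  have := p.isPrime
  have := P.isPrime
  have hcomap : p.asIdeal = P.asIdeal.comap (algebraMap (𝓞 K) (𝓞 L)) := rfl
  let i : 𝓞 K ⧸ p.asIdeal →+* 𝓞 L ⧸ P.asIdeal :=
    Ideal.quotientMap P.asIdeal (algebraMap (𝓞 K) (𝓞 L)) hcomap.le
  have hi : Function.Injective i := Ideal.quotientMap_injective' hcomap.ge
  have hcomp : i.comp (Ideal.Quotient.mk p.asIdeal) =
    (Ideal.Quotient.mk P.asIdeal).comp (algebraMap (𝓞 K) (𝓞 L)) := Ideal.quotientMap_comp_mk _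
  have hsplit : (f.map (Ideal.Quotient.mk p.asIdeal)).Splits := hP
  -- Since `f` splits modulo `p`, the root `x` is congruent modulo `P` to some `c` in `𝓞 K`. As `σ`
  -- fixes `c` and `P`, also `σ • x ≡ c ≡ x`, and distinct roots are not congruent.
  have hroot : ∀ x ∈ F.roots, σ • x = x := fun x hx ↦ by
    have hxF : F.eval x = 0 := isRoot_of_mem_roots hx
    have hσx : σ • x ∈ F.roots := by
      rw [mem_roots hF0, IsRoot.def, hF, eval_map_algebraMap, Polynomial.aeval_smul,
        ← eval_map_algebraMap, ← hF, hxF, smul_zero]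
    have hmod : ((f.map (Ideal.Quotient.mk p.asIdeal)).map i).eval
        (Ideal.Quotient.mk P.asIdeal x) = 0 := by
      rw [Polynomial.map_map, hcomp, ← Polynomial.map_map, ← hF, eval_map_apply, hxF, map_zero]
    have hmem : Ideal.Quotient.mk P.asIdeal x ∈
        ((f.map (Ideal.Quotient.mk p.asIdeal)).map i).roots := by
      rw [mem_roots ((hf.map _).map _).ne_zero]; exact hmod
    rw [hsplit.roots_map_of_injective hi, Multiset.mem_map] at hmem
    obtain ⟨c, -, hc⟩ := hmem
    obtain ⟨c, rfl⟩ := Ideal.Quotient.mk_surjective c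
    have hc' : Ideal.Quotient.mk P.asIdeal (algebraMap (𝓞 K) (𝓞 L) c) =
        Ideal.Quotient.mk P.asIdeal x := by
      rw [← hc, ← RingHom.comp_apply, ← hcomp, RingHom.comp_apply]
    have h1 : x - algebraMap (𝓞 K) (𝓞 L) c ∈ P.asIdeal :=
      Ideal.Quotient.eq.mp hc'.symm
    have h2 : σ • x - algebraMap (𝓞 K) (𝓞 L) c ∈ P.asIdeal := by
      have h := Ideal.smul_mem_pointwise_smul σ _ _ h1
      rwa [hσ, smul_sub, smul_algebraMap] at h
    refine hdist _ hσx _ hx ?_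
    have := P.asIdeal.sub_mem h2 h1
    rwa [sub_sub_sub_cancel_right] at this
  refine AlgEquiv.ext fun z ↦ ?_
  suffices h : (σ : L →ₐ[K] L) = AlgHom.id K L from DFunLike.congr_fun h z
  refine AlgHom.ext_of_adjoin_eq_top hL.adjoin_rootSet' fun a ha ↦ ?_
  have ha' := (mem_rootSet.mp ha).2
  rw [aeval_map_algebraMap] at ha'
  have hint : IsIntegral (𝓞 K) a := ⟨f, hf, by rwa [← aeval_def]⟩
  obtain ⟨y, hy⟩ := IsIntegrallyClosed.isIntegral_iff.mp (hint.tower_top (A := 𝓞 L))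
  have hyF : y ∈ F.roots := by
    rw [mem_roots hF0, IsRoot.def, hF, eval_map_algebraMap]
    refine FaithfulSMul.algebraMap_injective (𝓞 L) L ?_
    rw [← aeval_algebraMap_apply, hy, ha', map_zero]
  have h := congrArg (algebraMap (𝓞 L) L) (hroot y hyF)
  rw [algebraMap.smul'] at h
  rw [hy] at h
  exact h

/-- The Galois group is transitive on the primes above `p`, so a trivial stabilizer makes the orbit
as large as the group. -/
lemma card_fiber_under_eq [IsGalois K L] (P : HeightOneSpectrum (𝓞 L))
    (h : ∀ σ : Gal(L/K), σ • P.asIdeal = P.asIdeal → σ = 1) :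
    Nat.card {Q : HeightOneSpectrum (𝓞 L) // Q.under (𝓞 K) = P.under (𝓞 K)} =
      Module.finrank K L := by
  set p := P.under (𝓞 K) with hp
  have := p.isMaximal
  have := P.isPrime
  have : P.asIdeal.LiesOver p.asIdeal := ⟨rfl⟩
  have horb := Algebra.IsInvariant.orbit_eq_primesOver (𝓞 K) (𝓞 L) Gal(L/K) p.asIdeal P.asIdeal
  have hinj : Function.Injective fun σ : Gal(L/K) ↦ σ • P.asIdeal := fun σ τ hστ ↦ by
    refine (inv_mul_eq_one.mp (h (τ⁻¹ * σ) ?_)).symm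
    rw [mul_smul, show σ • P.asIdeal = τ • P.asIdeal from hστ, inv_smul_smul]
  rw [card_fiber_under, ← Set.ncard_coe_finset, IsDedekindDomain.coe_primesOverFinset p.ne_bot, ← horb,
    ← IsGalois.card_aut_eq_finrank K L, MulAction.orbit, ← Set.image_univ,
    Set.ncard_image_of_injective _ hinj, Set.ncard_univ]

/-- The primes modulo which two distinct elements of a finite set become congruent. -/
lemma finite_setOf_exists_sub_mem {R : Type*} [CommRing R] [IsDedekindDomain R] (S : Finset R) :
    {P : HeightOneSpectrum R | ∃ x ∈ S, ∃ y ∈ S, x ≠ y ∧ x - y ∈ P.asIdeal}.Finite := by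
  classical
  have : {P : HeightOneSpectrum R | ∃ x ∈ S, ∃ y ∈ S, x ≠ y ∧ x - y ∈ P.asIdeal} ⊆
      ⋃ z ∈ S.offDiag, {P : HeightOneSpectrum R | P.asIdeal ∣ Ideal.span {z.1 - z.2}} := by
    rintro P ⟨x, hx, y, hy, hxy, h⟩
    refine Set.mem_biUnion (x := (x, y)) (Finset.mem_coe.mpr (Finset.mem_offDiag.mpr ⟨hx, hy, hxy⟩)) ?_
    exact Ideal.dvd_span_singleton.mpr h
  refine Set.Finite.subset (Set.Finite.biUnion S.offDiag.finite_toSet fun z hz ↦ ?_) this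
  refine Ideal.finite_factors ?_
  rw [Ne, Ideal.zero_eq_bot, Ideal.span_singleton_eq_bot, sub_eq_zero]
  exact (Finset.mem_offDiag.mp hz).2.2

/-- Away from finitely many primes, the primes modulo which `f` splits are completely decomposed
in the splitting field. -/
lemma exists_finite_completely_split {f : (𝓞 K)[X]} (hf : f.Monic)
    (hL : IsSplittingField K L (f.map (algebraMap (𝓞 K) K))) [IsGalois K L] :
    ∃ B : Set (HeightOneSpectrum (𝓞 K)), B.Finite ∧
      ∀ P : HeightOneSpectrum (𝓞 L), P.under (𝓞 K) ∈ splittingPrimes f → P.under (𝓞 K) ∉ B →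
        Nat.card {Q : HeightOneSpectrum (𝓞 L) // Q.under (𝓞 K) = P.under (𝓞 K)} =
          Module.finrank K L ∧
        Ideal.absNorm P.asIdeal = Ideal.absNorm (P.under (𝓞 K)).asIdeal := by
  classical
  -- `B` consists of the primes of `K` lying below a prime of `L` at which two distinct roots of `f`
  -- become congruent.
  refine ⟨_, (finite_setOf_exists_sub_mem
    (f.map (algebraMap (𝓞 K) (𝓞 L))).roots.toFinset).image (HeightOneSpectrum.under (𝓞 K)),
    fun P hP hB ↦ ?_⟩
  have hcard := card_fiber_under_eq (K := K) P (eq_one_of_smul_eq hf hL P hP fun x hx y hy hxy ↦ by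
    by_contra hne
    exact hB ⟨P, ⟨x, Multiset.mem_toFinset.mpr hx, y, Multiset.mem_toFinset.mpr hy, hne, hxy⟩, rfl⟩)
  exact ⟨hcard, absNorm_eq_absNorm_under_of_card_fiber P hcard⟩

end RelativePrimes

/-! ### Comparison of the two zeta functions and the density. -/

section PolarDensity

lemma differentiableOn_tsum_of_finite_compl {ι : Type*} {F : ι → ℂ → ℂ} {U : Set ℂ} {B : Set ι}
    {u : ι → ℝ} (hU : IsOpen U) (hB : B.Finite) (hF : ∀ i, DifferentiableOn ℂ (F i) U)
    (hu : Summable u) (h : ∀ i ∉ B, ∀ s ∈ U, ‖F i s‖ ≤ u i) :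
    DifferentiableOn ℂ (fun s ↦ ∑' i, F i s) U := by
  have hc : Summable fun i : ((hB.toFinset : Set ι)ᶜ : Set ι) ↦ u i := hu.subtype _
  have hbd : ∀ (i : ((hB.toFinset : Set ι)ᶜ : Set ι)) (s : ℂ), s ∈ U → ‖F i s‖ ≤ u i :=
    fun i s hs ↦ h i (by simpa using i.2) s hs
  have hsum : ∀ s ∈ U, Summable fun i ↦ F i s := fun s hs ↦
    hB.toFinset.summable_compl_iff.mp (Summable.of_norm_bounded hc fun i ↦ hbd i s hs)
  refine DifferentiableOn.congr (f := fun s ↦ ∑ i ∈ hB.toFinset, F i s +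
    ∑' i : ((hB.toFinset : Set ι)ᶜ : Set ι), F i s) ?_
    fun s hs ↦ ((hsum s hs).sum_add_tsum_compl (s := hB.toFinset)).symm
  exact (DifferentiableOn.fun_sum fun i _ ↦ hF i).add
    (Complex.differentiableOn_tsum_of_summable_norm hc (fun i ↦ hF i) hU hbd)

/-- Any bound above `1/2` would do in place of `3/4`: it turns the norm `≥ N ^ 2` into the exponent
`3/2 > 1`. The factor `3/2` is the bound for `|log (1 + z)| / |z|` when `‖z‖ ≤ 1/2`. -/
lemma norm_logEulerFactor_le {K : Type*} [Field K] [NumberField K] {P : HeightOneSpectrum (𝓞 K)}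
    {N : ℕ} (hN : 2 ≤ N) (hP : N ^ 2 ≤ Ideal.absNorm P.asIdeal) {s : ℂ} (hs : 3 / 4 ≤ s.re) :
    ‖logEulerFactor P s‖ ≤ 3 / 2 * (N : ℝ) ^ (-(3 / 2) : ℝ) := by
  have hN' : (2 : ℝ) ≤ N := by exact_mod_cast hN
  have hP' : (N : ℝ) ^ 2 ≤ Ideal.absNorm P.asIdeal := by exact_mod_cast hP
  have h1 : ‖(Ideal.absNorm P.asIdeal : ℂ) ^ (-s)‖ ≤ (N : ℝ) ^ (-(3 / 2) : ℝ) := by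
    rw [norm_absNorm_cpow]
    calc (Ideal.absNorm P.asIdeal : ℝ) ^ (-s.re)
        ≤ (Ideal.absNorm P.asIdeal : ℝ) ^ (-(3 / 4) : ℝ) :=
          Real.rpow_le_rpow_of_exponent_le (by nlinarith) (by linarith)
      _ ≤ ((N : ℝ) ^ 2) ^ (-(3 / 4) : ℝ) :=
          Real.rpow_le_rpow_of_nonpos (by positivity) hP' (by norm_num)
      _ = (N : ℝ) ^ (-(3 / 2) : ℝ) := by
          rw [← Real.rpow_natCast_mul (by positivity)]; norm_num
  have h2 : (N : ℝ) ^ (-(3 / 2) : ℝ) ≤ 1 / 2 := by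
    calc (N : ℝ) ^ (-(3 / 2) : ℝ) ≤ (N : ℝ) ^ (-1 : ℝ) :=
          Real.rpow_le_rpow_of_exponent_le (by linarith) (by norm_num)
      _ = (N : ℝ)⁻¹ := Real.rpow_neg_one _
      _ ≤ 1 / 2 := by rw [one_div]; exact inv_anti₀ (by norm_num) hN'
  have h3 := Complex.norm_log_one_add_half_le_self
    (z := -(Ideal.absNorm P.asIdeal : ℂ) ^ (-s)) (by rw [norm_neg]; exact h1.trans h2)
  rw [logEulerFactor, norm_neg, sub_eq_add_neg]
  rw [norm_neg] at h3
  linarith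

lemma nonempty_fiber_under {K : Type*} (L : Type*) [Field K] [Field L] [Algebra K L]
    (p : HeightOneSpectrum (𝓞 K)) :
    Nonempty {P : HeightOneSpectrum (𝓞 L) // P.under (𝓞 K) = p} := by
  have := p.isPrime
  obtain ⟨⟨Q, hQ, hQp⟩⟩ := Ideal.nonempty_primesOver (S := 𝓞 L) (P := p.asIdeal)
  exact ⟨⟨Q, hQ, Ideal.ne_bot_of_mem_primesOver p.ne_bot ⟨hQ, hQp⟩⟩,
    HeightOneSpectrum.ext hQp.over.symm⟩

variable {K : Type*} (L : Type*) [Field K] [Field L] [NumberField L] [Algebra K L]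

/-- The sum of the logarithms of the Euler factors of `L` at the primes above `p`. -/
noncomputable def fiberLogEulerFactor (p : HeightOneSpectrum (𝓞 K)) (s : ℂ) : ℂ :=
  ∑' P : {P : HeightOneSpectrum (𝓞 L) // P.under (𝓞 K) = p}, logEulerFactor P.1 s

lemma hasSum_fiberLogEulerFactor {s : ℂ} (hs : 1 < s.re) :
    HasSum (fun p : HeightOneSpectrum (𝓞 K) ↦ fiberLogEulerFactor L p s)
      (∑' P : HeightOneSpectrum (𝓞 L), logEulerFactor P s) :=
  (summable_logEulerFactor L hs).hasSum.tsum_fiberwise (HeightOneSpectrum.under (𝓞 K))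

variable [NumberField K]

lemma differentiableAt_fiberLogEulerFactor (p : HeightOneSpectrum (𝓞 K)) {s : ℂ}
    (hs : 0 < s.re) : DifferentiableAt ℂ (fiberLogEulerFactor L p) s := by
  have := Fintype.ofFinite {P : HeightOneSpectrum (𝓞 L) // P.under (𝓞 K) = p}
  unfold fiberLogEulerFactor
  simp only [tsum_fintype]
  exact DifferentiableAt.fun_sum fun P _ ↦ differentiableAt_logEulerFactor P.1 hs

lemma norm_fiberLogEulerFactor_le {f : (𝓞 K)[X]}
    (hf : (f.map (algebraMap (𝓞 K) (𝓞 L))).Splits) {p : HeightOneSpectrum (𝓞 K)}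
    (hp : p ∉ splittingPrimes f) {s : ℂ} (hs : 3 / 4 ≤ s.re) :
    ‖fiberLogEulerFactor L p s‖ ≤
      Module.finrank K L * (3 / 2 * (Ideal.absNorm p.asIdeal : ℝ) ^ (-(3 / 2) : ℝ)) := by
  have := Fintype.ofFinite {P : HeightOneSpectrum (𝓞 L) // P.under (𝓞 K) = p}
  rw [fiberLogEulerFactor, tsum_fintype]
  refine (norm_sum_le_of_le _ (f := fun P : {P : HeightOneSpectrum (𝓞 L) // P.under (𝓞 K) = p} ↦
    logEulerFactor P.1 s) (n := fun _ ↦ 3 / 2 * (Ideal.absNorm p.asIdeal : ℝ) ^ (-(3 / 2) : ℝ))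
    fun P _ ↦ ?_).trans ?_
  · refine norm_logEulerFactor_le (two_le_absNorm p) ?_ hs
    have h := absNorm_under_sq_le (K := K) hf P.1 (by rwa [P.2])
    rwa [P.2] at h
  · rw [Finset.sum_const, nsmul_eq_mul, Finset.card_univ, ← Nat.card_eq_fintype_card]
    refine mul_le_mul_of_nonneg_right (Nat.cast_le.mpr (card_fiber_under_le p)) (by positivity)

lemma fiberLogEulerFactor_eq {p : HeightOneSpectrum (𝓞 K)}
    (h : ∀ P : HeightOneSpectrum (𝓞 L), P.under (𝓞 K) = p →
      Nat.card {Q : HeightOneSpectrum (𝓞 L) // Q.under (𝓞 K) = p} = Module.finrank K L ∧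
      Ideal.absNorm P.asIdeal = Ideal.absNorm p.asIdeal) (s : ℂ) :
    fiberLogEulerFactor L p s = Module.finrank K L * logEulerFactor p s := by
  have := Fintype.ofFinite {P : HeightOneSpectrum (𝓞 L) // P.under (𝓞 K) = p}
  obtain ⟨P⟩ := nonempty_fiber_under L p
  rw [fiberLogEulerFactor, tsum_fintype, ← (h P.1 P.2).1, Nat.card_eq_fintype_card,
    ← nsmul_eq_mul]
  refine Finset.sum_eq_card_nsmul fun Q _ ↦ ?_
  rw [logEulerFactor, logEulerFactor, (h Q.1 Q.2).2]

/-- Up to a function `exp ∘ H` with `H` holomorphic around `1`, the `[L : K]`-th power of the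
partial zeta function of the splitting primes of `f` is the Dedekind zeta function of `L`. -/
lemma exists_partialDedekindZeta_pow_eq {f : (𝓞 K)[X]} (hf : f.Monic)
    (hL : IsSplittingField K L (f.map (algebraMap (𝓞 K) K))) [IsGalois K L] :
    ∃ H : ℂ → ℂ, DifferentiableOn ℂ H {s | 3 / 4 < s.re} ∧ ∀ s : ℂ, 1 < s.re →
      partialDedekindZeta (splittingPrimes f) s ^ Module.finrank K L =
        dedekindZeta L s * Complex.exp (-H s) := by
  classical
  set n := Module.finrank K L with hn
  set A := splittingPrimes f with hA
  obtain ⟨B, hB, hsplit⟩ := exists_finite_completely_split (L := L) hf hL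
  -- `F p` vanishes identically for `p ∈ A` outside `B`, and is `O(N(p) ^ (-3/2))` for `p ∉ A`; the
  -- finitely many `p ∈ B` only need to be holomorphic.
  let F : HeightOneSpectrum (𝓞 K) → ℂ → ℂ := fun p s ↦
    fiberLogEulerFactor L p s - n * if p ∈ A then logEulerFactor p s else 0
  have hdiff : DifferentiableOn ℂ (fun s ↦ ∑' p, F p s) {s | 3 / 4 < s.re} := by
    refine differentiableOn_tsum_of_finite_compl (B := B)
      (u := fun p ↦ n * (3 / 2 * (Ideal.absNorm p.asIdeal : ℝ) ^ (-(3 / 2) : ℝ)))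
      (isOpen_lt continuous_const Complex.continuous_re) hB (fun p s hs ↦ ?_)
      (((summable_absNorm_prime_rpow K (by norm_num)).mul_left _).mul_left _) fun p hp s hs ↦ ?_
    · have hs0 : 0 < s.re := by linarith [show 3 / 4 < s.re from hs]
      refine DifferentiableAt.differentiableWithinAt
        ((differentiableAt_fiberLogEulerFactor L p hs0).sub (DifferentiableAt.const_mul ?_ _))
      by_cases h : p ∈ A
      · simpa only [if_pos h] using differentiableAt_logEulerFactor p hs0
      · simp only [if_neg h, differentiableAt_const]
    · by_cases h : p ∈ A
      · have hF : F p s = 0 := by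
          simp only [F, if_pos h]
          rw [fiberLogEulerFactor_eq L (p := p) (fun P hP ↦ by
            subst hP; exact hsplit P h hp), sub_self]
        rw [hF, norm_zero]
        positivity
      · simp only [F, if_neg h, mul_zero, sub_zero]
        exact norm_fiberLogEulerFactor_le L (splits_map_ringOfIntegers hf hL) h (le_of_lt hs)
  refine ⟨_, hdiff, fun s hs ↦ ?_⟩
  have hsumA : HasSum (fun p ↦ if p ∈ A then logEulerFactor p s else 0)
      (∑' P : A, logEulerFactor P.1 s) :=
    hasSum_subtype_iff_indicator.mp
      ((summable_logEulerFactor K hs).subtype A).hasSum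
  have hsumF : HasSum (fun p ↦ F p s) (∑' P : HeightOneSpectrum (𝓞 L), logEulerFactor P s -
      n * ∑' P : A, logEulerFactor P.1 s) :=
    (hasSum_fiberLogEulerFactor L hs).sub (hsumA.mul_left _)
  rw [hsumF.tsum_eq, partialDedekindZeta_eq_exp A hs, dedekindZeta_eq_exp hs, ← Complex.exp_add,
    ← Complex.exp_nat_mul]
  congr 1
  ring

end PolarDensity

theorem corollary2 {K : Type*} [Field K] [NumberField K] {L : Type*} [Field L] [Algebra K L]
    (f : (𝓞 K)[X]) (hmonic : f.Monic) (hirr : Irreducible f)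
    (hL : IsSplittingField K L (f.map (algebraMap (𝓞 K) K))) :
    HasPolarDensity (splittingPrimes f) (1 / (Module.finrank K L : ℚ)) := by
  have : FiniteDimensional K L := hL.finiteDimensional
  have : NumberField L := NumberField.of_module_finite K L
  have : IsGalois K L :=
    { to_isSeparable := inferInstance
      to_normal := Normal.of_isSplittingField (f.map (algebraMap (𝓞 K) K)) }
  obtain ⟨H, hH, hζ⟩ := exists_partialDedekindZeta_pow_eq L hmonic hL
  obtain ⟨U, g, hU, h1U, hg, hgζ, hord⟩ := exists_meromorphicOn_eq_dedekindZeta L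
  have hV : IsOpen {s : ℂ | 3 / 4 < s.re} := isOpen_lt continuous_const Complex.continuous_re
  have hexp : AnalyticOnNhd ℂ (fun s ↦ Complex.exp (-H s)) {s : ℂ | 3 / 4 < s.re} :=
    (hH.neg.cexp).analyticOnNhd hV
  have h1V : (1 : ℂ) ∈ {s : ℂ | 3 / 4 < s.re} := by
    rw [Set.mem_ofPred_eq, Complex.one_re]; norm_num
  refine ⟨Module.finrank K L, 1, Module.finrank_pos, ⟨U ∩ {s | 3 / 4 < s.re},
    g * fun s ↦ Complex.exp (-H s), hU.inter hV, ⟨h1U, h1V⟩, ?_, fun s hs hs1 ↦ ?_, ?_⟩, by simp⟩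
  · exact fun s hs ↦ (hg s hs.1).mul (hexp s hs.2).meromorphicAt
  · rw [Pi.mul_apply, hgζ s hs.1 hs1, hζ s hs1]
  -- The exponential factor is holomorphic and nowhere zero, so the simple pole of `dedekindZeta L`
  -- survives unchanged.
  · rw [meromorphicOrderAt_mul (hg 1 h1U) (hexp 1 h1V).meromorphicAt, hord,
      (hexp 1 h1V).meromorphicOrderAt_eq, (hexp 1 h1V).analyticOrderAt_eq_zero.mpr
        (Complex.exp_ne_zero _)]
    rfl
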